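/- **Setting.** Let $k\ge 2$. A dominating meromorphic self-map $f=[F_0:\dots:F_k]$ of $\mathbb P^k=\mathbb P^k(\mathbb C)$ is given by homogeneous polynomials $F_0,\dots,F_k\in\mathbb C[z_0,\dots,z_k]$ of the same degree $d$ without nontrivial common factor (a lifting $F$ of $f$) whose Jacobian determinant $\det(\partial F_i/\partial z_j)$ is not identically zero. The number $\mathrm d(f):=d$ is the algebraic degree of $f$, and the common zero set $\mathcal I(f)\subset\mathbb P^k$ of the $F_i$ is its indeterminacy locus. The iterates $f^n$ are taken as meromorphic maps: a lifting of $f^{n+1}$ is obtained from the composite of liftings of $f^n$ and $f$ by removing the greatest common factor of the components. For an algebraic set $A\subset\mathbb P^k$, $f(A)$ denotes the closure of the image of $A\setminus\mathcal I(f)$ under $f$, and $f^n(A)$ denotes the image in this sense under the meromorphic map $f^n$. A hypersurface is an algebraic set of pure codimension $1$. The map $f$ is *algebraically stable* (AS) if there are no hypersurface $\mathcal H$ and no $N\ge1$ with $f^N(\mathcal H)\subset\mathcal I(f)$. A hypersurface $\mathcal H$ is *degree lowering* if $f^n(\mathcal H)\subset\mathcal I(f)$ for some $n\ge 1$; the smallest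 such $n$ is its *height*. Let $\mathcal F$ be the family of all degree lowering irreducible hypersurfaces $\mathcal H$ such that $\operatorname{codim} f^m(\mathcal H)>1$ for $1\le m\le n$, where $n$ is the height of $\mathcal H$. For each $n$ that occurs as a height of an element of $\mathcal F$, the union of all elements of $\mathcal F$ of height $n$ is called the *primitive degree lowering hypersurface* of $f$ with height $n$. The map $f$ is *quasi-algebraically stable* (QAS) if either it is AS or (i) there is exactly one primitive degree lowering hypersurface; denote it by $\mathcal H_0$ and its height by $n_0$; (ii) for every irreducible component $\mathcal H$ of $\mathcal H_0$ and every $m=1,\dots,n_0$, $f^m(\mathcal H)\not\subset\mathcal H_0$; (iii) for every irreducible component $\mathcal H$ of $\mathcal H_0$, either $f^m(\mathcal H)\not\subset\mathcal I(f)$ for all $m\ge n_0+1$, or there is an $m_0\ge n_0$ such that $f^{m_0+1}(\mathcal H)$ is a hypersurface and $f^m(\mathcal H)\not\subset\mathcal I(f)$ for all $m$ with $n_0+1\le m\le m_0$. **Theorem.** Let $k\ge2$ and let $f$ be a QAS dominating meromorphic self-map of $\mathbb P^k$. Then the limit $\lambda_1(f):=\lim_{n\to\infty}\mathrm d(f^n)^{1/n}$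 (the first dynamical degree of $f$) exists and is an algebraic integer, and $$\lim_{n\to\infty}\frac{\mathrm d(f^{n+1})}{\mathrm d(f^n)}=\lambda_1(f).$$ -/

import Mathlib

open MvPolynomial Filter Topology
open scoped Matrix

namespace ProjDyn

/-- Complex projective space `ℙ^k`. -/
abbrev ProjSpace (k : ℕ) : Type := Projectivization ℂ (Fin (k + 1) → ℂ)

/-- The matrix `(∂F_i / ∂z_j)` of a polynomial map `F : ℂ^(k+1) → ℂ^(k+1)`. -/
noncomputable def jacobianMatrix {k : ℕ} (F : Fin (k + 1) → MvPolynomial (Fin (k + 1)) ℂ) :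
    Matrix (Fin (k + 1)) (Fin (k + 1)) (MvPolynomial (Fin (k + 1)) ℂ) :=
  Matrix.of fun i j => pderiv j (F i)

/-- The chain rule. -/
theorem pderiv_bind₁ {k : ℕ} (F : Fin (k + 1) → MvPolynomial (Fin (k + 1)) ℂ)
    (P : MvPolynomial (Fin (k + 1)) ℂ) (j : Fin (k + 1)) :
    pderiv j (bind₁ F P) = ∑ i, bind₁ F (pderiv i P) * pderiv j (F i) := by
  classical
  induction P using MvPolynomial.induction_on with
  | C a => simp
  | add p q hp hq => simp [hp, hq, add_mul, Finset.sum_add_distrib]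
  | mul_X p i hp =>
    have h : ∀ l, bind₁ F (pderiv l (p * X i)) * pderiv j (F l) =
        (bind₁ F (pderiv l p) * pderiv j (F l)) * F i +
          (if l = i then bind₁ F p * pderiv j (F i) else 0) := by
      intro l
      rw [pderiv_mul, map_add, map_mul, map_mul, bind₁_X_right]
      split_ifs with hl
      · rw [hl, pderiv_X_self, map_one]; ring
      · rw [pderiv_X_of_ne (Ne.symm hl), map_zero]; ring
    rw [Finset.sum_congr rfl fun l _ => h l, Finset.sum_add_distrib, ← Finset.sum_mul, ← hp,
      Finset.sum_ite_eq' Finset.univ i, if_pos (Finset.mem_univ i), map_mul, bind₁_X_right,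
      pderiv_mul]

/-- A polynomial map with nonvanishing Jacobian determinant pulls back nonzero polynomials to
nonzero polynomials. -/
theorem bind₁_ne_zero {k : ℕ} {F : Fin (k + 1) → MvPolynomial (Fin (k + 1)) ℂ}
    (hF : (jacobianMatrix F).det ≠ 0) {P : MvPolynomial (Fin (k + 1)) ℂ} (hP : P ≠ 0) :
    bind₁ F P ≠ 0 := by
  suffices H : ∀ n : ℕ, ∀ P : MvPolynomial (Fin (k + 1)) ℂ, P.totalDegree ≤ n →
      bind₁ F P = 0 → P = 0 from fun h => hP (H _ P le_rfl h)
  intro n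
  induction n with
  | zero =>
    intro P hd h0
    rw [totalDegree_eq_zero_iff_eq_C.mp (Nat.le_zero.mp hd)] at h0 ⊢
    simpa using h0
  | succ n ih =>
    intro P hd h0
    have hu : (fun i => bind₁ F (pderiv i P)) = 0 := by
      apply Matrix.eq_zero_of_vecMul_eq_zero hF
      funext j
      have := pderiv_bind₁ F P j
      rw [h0, map_zero] at this
      simpa [Matrix.vecMul, dotProduct, jacobianMatrix] using this.symm
    have hp : ∀ i, pderiv i P = 0 := by
      intro i
      refine ih _ ?_ (congrFun hu i)
      refine Finset.sup_le fun m hm => ?_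
      have hm' : m + Finsupp.single i 1 ∈ P.support := by
        rw [mem_support_iff] at hm ⊢
        rw [coeff_pderiv] at hm
        exact left_ne_zero_of_mul hm
      have := (le_totalDegree hm').trans hd
      rw [Finsupp.sum_add_index' (by simp) (by simp)] at this
      simpa using this
    have hC : P = C (coeff 0 P) := by
      ext m
      rw [coeff_C]
      split_ifs with h
      · rw [h]
      · obtain ⟨i, hi⟩ : ∃ i, m i ≠ 0 := by
          by_contra! hh
          exact h (Finsupp.ext fun i => (hh i).symm)
        have := congrArg (coeff (m - Finsupp.single i 1)) (hp i)
        rw [coeff_pderiv, tsub_add_cancel_of_le (by simpa [Nat.one_le_iff_ne_zero] using hi)] at this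
        simp only [coeff_zero, mul_eq_zero] at this
        refine this.resolve_right ?_
        exact Nat.cast_add_one_ne_zero _
    rw [hC] at h0 ⊢
    simpa using h0

/-- Factors of homogeneous polynomials are homogeneous. -/
theorem isHomogeneous_of_mul {k : ℕ} {P Q : MvPolynomial (Fin (k + 1)) ℂ} {n : ℕ}
    (h : (P * Q).IsHomogeneous n) (hP : P ≠ 0) (hQ : Q ≠ 0) :
    ∃ a b, a + b = n ∧ P.IsHomogeneous a ∧ Q.IsHomogeneous b := by
  let φ : MvPolynomial (Fin (k + 1)) ℂ →ₐ[ℂ] Polynomial (MvPolynomial (Fin (k + 1)) ℂ) :=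
    aeval fun i => Polynomial.C (X i) * Polynomial.X
  have hmon : ∀ (m : Fin (k + 1) →₀ ℕ) (c : ℂ),
      φ (monomial m c) = Polynomial.monomial m.degree (monomial m c) := by
    intro m c
    simp only [φ, aeval_monomial, mul_pow, Finsupp.prod_mul]
    rw [← Polynomial.C_mul_X_pow_eq_monomial, monomial_eq, Polynomial.C_mul]
    simp only [Finsupp.prod, Finset.prod_pow_eq_pow_sum, map_prod, map_pow]
    rw [← mul_assoc]
    rfl
  have hcoeff : ∀ (R : MvPolynomial (Fin (k + 1)) ℂ) (a : ℕ),
      (φ R).coeff a = homogeneousComponent a R := by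
    intro R a
    induction R using MvPolynomial.induction_on' with
    | monomial m c =>
      rw [hmon, Polynomial.coeff_monomial]
      rw [homogeneousComponent_of_mem (isHomogeneous_monomial c rfl)]
      simp [eq_comm]
    | add p q hp hq => simp [hp, hq]
  have hhom : ∀ (R : MvPolynomial (Fin (k + 1)) ℂ) (a : ℕ), R.IsHomogeneous a →
      φ R = Polynomial.monomial a R := by
    intro R a hR
    ext1 b
    rw [hcoeff, Polynomial.coeff_monomial, homogeneousComponent_of_mem hR]
    simp [eq_comm]
  have hone : ∀ R, (φ R).eval 1 = R := by
    intro R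
    induction R using MvPolynomial.induction_on' with
    | monomial m c => simp [hmon]
    | add p q hp hq => simp [hp, hq]
  have hne : ∀ R, R ≠ 0 → φ R ≠ 0 := fun R hR h0 => hR (by rw [← hone R, h0]; simp)
  have hmul := hhom _ _ h
  rw [map_mul] at hmul
  have h1 := Polynomial.natDegree_mul (hne P hP) (hne Q hQ)
  have h2 := Polynomial.natTrailingDegree_mul (hne P hP) (hne Q hQ)
  rw [hmul, Polynomial.natDegree_monomial_eq _ (mul_ne_zero hP hQ)] at h1
  rw [hmul, Polynomial.natTrailingDegree_monomial (mul_ne_zero hP hQ)] at h2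
  have h3 := Polynomial.natTrailingDegree_le_natDegree (φ P)
  have h4 := Polynomial.natTrailingDegree_le_natDegree (φ Q)
  have key : ∀ R, (φ R).natTrailingDegree = (φ R).natDegree →
      R.IsHomogeneous (φ R).natDegree := by
    intro R hR
    have : φ R = Polynomial.monomial (φ R).natDegree ((φ R).coeff (φ R).natDegree) := by
      ext1 b
      rw [Polynomial.coeff_monomial]
      split_ifs with hb
      · rw [hb]
      · rcases lt_or_gt_of_ne hb with hb | hb
        · exact Polynomial.coeff_eq_zero_of_natDegree_lt hb
        · exact Polynomial.coeff_eq_zero_of_lt_natTrailingDegree (hR ▸ hb)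
    have h' := hone R
    rw [this, Polynomial.eval_monomial, one_pow, mul_one, hcoeff] at h'
    rw [← h']
    have h'' := homogeneousComponent_isHomogeneous (φ R).natDegree R
    rwa [h'] at h'' ⊢
  exact ⟨_, _, h1.symm, key P (by omega), key Q (by omega)⟩

/-- A homogeneous polynomial map with nonvanishing Jacobian determinant is a polynomial multiple
of a map of the same kind whose components have no nontrivial common factor. -/
theorem exists_reduced {k : ℕ} (hk : 1 ≤ k) {A : Fin (k + 1) → MvPolynomial (Fin (k + 1)) ℂ} {m : ℕ}
    (hA : ∀ i, (A i).IsHomogeneous m) (hJ : (jacobianMatrix A).det ≠ 0) :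
    ∃ (H : MvPolynomial (Fin (k + 1)) ℂ) (L : Fin (k + 1) → MvPolynomial (Fin (k + 1)) ℂ) (e : ℕ),
      H ≠ 0 ∧ (∀ i, A i = H * L i) ∧ (∀ i, (L i).IsHomogeneous e) ∧
      (∀ Q, (∀ i, Q ∣ L i) → IsUnit Q) ∧ (jacobianMatrix L).det ≠ 0 := by
  classical
  let : StrongNormalizationMonoid (MvPolynomial (Fin (k + 1)) ℂ) :=
    UniqueFactorizationMonoid.strongNormalizationMonoid
  let := UniqueFactorizationMonoid.toNormalizedGCDMonoid (MvPolynomial (Fin (k + 1)) ℂ)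
  obtain ⟨L, hL, hg⟩ := Finset.extract_gcd (s := Finset.univ) A Finset.univ_nonempty
  set H := Finset.univ.gcd A with hHdef
  have hA0 : A ≠ 0 := by
    rintro rfl
    apply hJ
    have : jacobianMatrix (0 : Fin (k + 1) → MvPolynomial (Fin (k + 1)) ℂ) = 0 := by
      ext1 i j; simp [jacobianMatrix]
    rw [this, Matrix.det_zero]
  obtain ⟨i₀, hi₀⟩ := Function.ne_iff.mp hA0
  have hAL : ∀ i, A i = H * L i := fun i => hL i (Finset.mem_univ i)
  have hH : H ≠ 0 := fun h => hi₀ (by rw [hAL, h, zero_mul]; rfl)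
  have hLi₀ : L i₀ ≠ 0 := fun h => hi₀ (by rw [hAL, h, mul_zero]; rfl)
  obtain ⟨a, e, hae, hHa, -⟩ := isHomogeneous_of_mul (hAL i₀ ▸ hA i₀) hH hLi₀
  have hLe : ∀ i, (L i).IsHomogeneous e := by
    intro i
    by_cases h : L i = 0
    · rw [h]; exact isHomogeneous_zero _ _ _
    · obtain ⟨a', e', hae', hHa', hL'⟩ := isHomogeneous_of_mul (hAL i ▸ hA i) hH h
      have : a = a' := hHa.inj_right hHa' hH
      rwa [show e = e' by omega]
  refine ⟨H, L, e, hH, hAL, hLe, ?_, ?_⟩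
  · intro Q hQ
    have := Finset.dvd_gcd (s := Finset.univ) (f := L) fun i _ => hQ i
    rw [hg] at this
    exact isUnit_of_dvd_one this
  · intro h0
    have hD : jacobianMatrix A = H • jacobianMatrix L +
        Matrix.vecMulVec L (fun j => pderiv j H) := by
      ext1 i j
      simp only [jacobianMatrix, Matrix.of_apply, Matrix.add_apply, Matrix.smul_apply,
        Matrix.vecMulVec_apply, hAL, pderiv_mul, smul_eq_mul]
      ring
    have hE : jacobianMatrix L *ᵥ (fun j => X j) = (e : MvPolynomial (Fin (k + 1)) ℂ) • L := by
      funext i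
      have := (hLe i).sum_X_mul_pderiv
      simp only [Matrix.mulVec, dotProduct, jacobianMatrix, Matrix.of_apply, Pi.smul_apply,
        smul_eq_mul]
      rw [nsmul_eq_mul] at this
      rw [← this]
      exact Finset.sum_congr rfl fun _ _ => mul_comm _ _
    rcases Nat.eq_zero_or_pos e with rfl | he
    · have : jacobianMatrix L = 0 := by
        ext1 i j
        have := totalDegree_eq_zero_iff_eq_C.mp (Nat.le_zero.mp (hLe i).totalDegree_le)
        simp only [jacobianMatrix, Matrix.of_apply, Matrix.zero_apply]
        rw [this, pderiv_C]
      rw [this, smul_zero, zero_add] at hD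
      have : Nontrivial (Fin (k + 1)) := Fin.nontrivial_iff_two_le.mpr (by omega)
      exact hJ (by rw [hD, Matrix.det_vecMulVec])
    · have he' : (e : MvPolynomial (Fin (k + 1)) ℂ) ≠ 0 := by exact_mod_cast he.ne'
      have : (e : MvPolynomial (Fin (k + 1)) ℂ) • jacobianMatrix A = jacobianMatrix L *
          ((e * H) • (1 : Matrix (Fin (k + 1)) (Fin (k + 1)) (MvPolynomial (Fin (k + 1)) ℂ)) +
            Matrix.vecMulVec (fun j => X j) (fun j => pderiv j H)) := by
        rw [mul_add, Matrix.mul_vecMulVec, hE, hD, smul_add, smul_smul, Matrix.mul_smul, mul_one,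
          Matrix.smul_vecMulVec]
      have := congrArg Matrix.det this
      rw [Matrix.det_smul, Matrix.det_mul, h0, zero_mul] at this
      exact mul_ne_zero (pow_ne_zero _ he') hJ this

/-- A dominating meromorphic self-map `f = [F_0 : ... : F_k]` of `ℙ^k`, given by a lifting: the
`F_i` are homogeneous of the same degree `d` without nontrivial common factor. The map is dominating
(generically of rank `k`) exactly when the Jacobian determinant of the lifting
`F : ℂ^(k+1) → ℂ^(k+1)` is not identically zero. A lifting is determined by the map up to a nonzero
constant; nothing below depends on that constant. -/
structure DominatingMap (k : ℕ) where
  /-- the lifting `F = (F_0, ..., F_k)` -/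
  lift : Fin (k + 1) → MvPolynomial (Fin (k + 1)) ℂ
  /-- the algebraic degree `d(f)` -/
  deg : ℕ
  homog : ∀ i, (lift i).IsHomogeneous deg
  coprime : ∀ Q : MvPolynomial (Fin (k + 1)) ℂ, (∀ i, Q ∣ lift i) → IsUnit Q
  dominating : (jacobianMatrix lift).det ≠ 0

/-- The locus in `ℙ^k` where the polynomial `P` vanishes (on all representatives; for homogeneous
`P` this does not depend on the representative). -/
def zeroLocus {k : ℕ} (P : MvPolynomial (Fin (k + 1)) ℂ) : Set (ProjSpace k) :=
  {p | ∀ (v : Fin (k + 1) → ℂ) (hv : v ≠ 0), Projectivization.mk ℂ v hv = p → eval v P = 0}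

/-- The smallest algebraic subset of `ℙ^k` containing `A`. -/
def algClosure {k : ℕ} (A : Set (ProjSpace k)) : Set (ProjSpace k) :=
  {q | ∀ (P : MvPolynomial (Fin (k + 1)) ℂ) (n : ℕ), P.IsHomogeneous n → A ⊆ zeroLocus P →
    q ∈ zeroLocus P}

/-- Hypersurfaces of `ℙ^k`: zero loci of nonconstant homogeneous polynomials. -/
def IsHypersurface {k : ℕ} (A : Set (ProjSpace k)) : Prop :=
  ∃ (P : MvPolynomial (Fin (k + 1)) ℂ) (n : ℕ),
    P ≠ 0 ∧ 0 < n ∧ P.IsHomogeneous n ∧ A = zeroLocus P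

/-- Irreducible hypersurfaces of `ℙ^k`: zero loci of irreducible homogeneous polynomials. -/
def IsIrreducibleHypersurface {k : ℕ} (A : Set (ProjSpace k)) : Prop :=
  ∃ (P : MvPolynomial (Fin (k + 1)) ℂ) (n : ℕ),
    Irreducible P ∧ P.IsHomogeneous n ∧ A = zeroLocus P

/-- `codim A > 1`, for an algebraic subset `A` of `ℙ^k`: it contains no hypersurface. -/
def CodimGtOne {k : ℕ} (A : Set (ProjSpace k)) : Prop :=
  ∀ H : Set (ProjSpace k), IsHypersurface H → ¬ H ⊆ A

/-- `C` is an irreducible component of the hypersurface `A`. -/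
def IsComponentOf {k : ℕ} (C A : Set (ProjSpace k)) : Prop :=
  IsIrreducibleHypersurface C ∧ C ⊆ A

namespace DominatingMap

variable {k : ℕ}

theorem one_le_dim (f : DominatingMap k) : 1 ≤ k := by
  rcases Nat.eq_zero_or_pos k with rfl | h
  · exfalso
    have hu : IsUnit (f.lift 0) := f.coprime _ fun i => by rw [Fin.fin_one_eq_zero i]
    have hc := MvPolynomial.isUnit_iff_eq_C_of_isReduced.mp hu
    obtain ⟨r, -, hr⟩ := hc
    refine f.dominating ?_
    have : jacobianMatrix f.lift = 0 := by
      ext1 i j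
      rw [Fin.fin_one_eq_zero i]
      simp [jacobianMatrix, hr]
    rw [this, Matrix.det_zero]
  · exact h

/-- The identity map of `ℙ^k`. -/
noncomputable def ident (hk : 1 ≤ k) : DominatingMap k where
  lift := X
  deg := 1
  homog i := isHomogeneous_X ℂ i
  coprime Q hQ := by
    have : Nontrivial (Fin (k + 1)) := Fin.nontrivial_iff_two_le.mpr (by omega)
    obtain ⟨i, j, hij⟩ := exists_pair_ne (Fin (k + 1))
    have hi : Irreducible (X i : MvPolynomial (Fin (k + 1)) ℂ) := (X_prime (R := ℂ)).irreducible
    refine (hi.dvd_iff.mp (hQ i)).resolve_right fun h => hij ?_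
    have h2 : (X i : MvPolynomial (Fin (k + 1)) ℂ) ∣ X j := h.dvd.trans (hQ j)
    exact X_dvd_X.mp h2
  dominating := by
    have : jacobianMatrix (X : Fin (k + 1) → MvPolynomial (Fin (k + 1)) ℂ) = 1 := by
      classical
      ext1 i j
      simp [jacobianMatrix, pderiv_X, Matrix.one_apply, Pi.single_apply]
    rw [this, Matrix.det_one]
    exact one_ne_zero

/-- `h = g ∘ f` as meromorphic maps: the polynomial map obtained by composing the liftings is a
polynomial multiple of the lifting of `h`. -/
def IsComp (g f h : DominatingMap k) : Prop :=
  ∃ H : MvPolynomial (Fin (k + 1)) ℂ, H ≠ 0 ∧ ∀ i, bind₁ f.lift (g.lift i) = H * h.lift i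

theorem exists_isComp (g f : DominatingMap k) : ∃ h, IsComp g f h := by
  have hhom : ∀ i, (bind₁ f.lift (g.lift i)).IsHomogeneous (f.deg * g.deg) := fun i =>
    (g.homog i).aeval f.lift f.homog
  have hjac : (jacobianMatrix fun i => bind₁ f.lift (g.lift i)).det ≠ 0 := by
    have h : (jacobianMatrix fun i => bind₁ f.lift (g.lift i)) =
        (bind₁ f.lift).toRingHom.mapMatrix (jacobianMatrix g.lift) * jacobianMatrix f.lift := by
      ext1 i j
      simp only [jacobianMatrix, Matrix.of_apply, pderiv_bind₁, Matrix.mul_apply]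
      rfl
    rw [h, Matrix.det_mul, ← RingHom.map_det]
    exact mul_ne_zero (bind₁_ne_zero f.dominating g.dominating) f.dominating
  obtain ⟨H, L, e, hH, hL, hLe, hcop, hdom⟩ := exists_reduced f.one_le_dim hhom hjac
  exact ⟨⟨L, e, hLe, hcop, hdom⟩, H, hH, hL⟩

/-- The composite `g ∘ f` of dominating meromorphic maps. -/
noncomputable def comp (g f : DominatingMap k) : DominatingMap k :=
  (exists_isComp g f).choose

theorem comp_spec (g f : DominatingMap k) : IsComp g f (comp g f) :=
  (exists_isComp g f).choose_spec

/-- The iterates `f^n`, as meromorphic maps: `f^(n+1) = f^n ∘ f`. -/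
noncomputable def iter (f : DominatingMap k) : ℕ → DominatingMap k
  | 0 => ident f.one_le_dim
  | n + 1 => comp (iter f n) f

/-- The lifting as a map `ℂ^(k+1) → ℂ^(k+1)`. -/
noncomputable def evalLift (f : DominatingMap k) (v : Fin (k + 1) → ℂ) : Fin (k + 1) → ℂ :=
  fun i => eval v (f.lift i)

/-- The indeterminacy locus `I(f)`: the common zero set of the components of the lifting. -/
def indet (f : DominatingMap k) : Set (ProjSpace k) :=
  {p | ∀ i, p ∈ zeroLocus (f.lift i)}

/-- The image `f(A)`: the closure of `f (A \ I(f))`. For algebraic `A` the set `f (A \ I(f))` is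
constructible, so that its closure is the smallest algebraic set containing it. -/
def image (f : DominatingMap k) (A : Set (ProjSpace k)) : Set (ProjSpace k) :=
  algClosure {q | ∃ (v : Fin (k + 1) → ℂ) (hv : v ≠ 0) (hw : f.evalLift v ≠ 0),
    Projectivization.mk ℂ v hv ∈ A ∧ q = Projectivization.mk ℂ (f.evalLift v) hw}

/-- `f` is algebraically stable: no hypersurface is sent to `I(f)` by an iterate `f^N`, `N ≥ 1`. -/
def IsAS (f : DominatingMap k) : Prop :=
  ∀ (H : Set (ProjSpace k)) (N : ℕ), IsHypersurface H → 1 ≤ N →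
    ¬ (f.iter N).image H ⊆ f.indet

/-- `H` is degree lowering with height `n`: `n` is the smallest integer `n ≥ 1` such that
`f^n(H) ⊆ I(f)`. -/
def HasHeight (f : DominatingMap k) (H : Set (ProjSpace k)) (n : ℕ) : Prop :=
  IsLeast {n : ℕ | 1 ≤ n ∧ (f.iter n).image H ⊆ f.indet} n

/-- The degree lowering irreducible hypersurfaces `H` of height `n` such that
`codim f^m(H) > 1` for `m = 1, ..., n`. (Such an `H` is automatically a component of the critical
set of `f`, because `codim f(H) > 1`.) -/
def IsPrimitiveComponent (f : DominatingMap k) (H : Set (ProjSpace k)) (n : ℕ) : Prop :=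
  IsIrreducibleHypersurface H ∧ f.HasHeight H n ∧
    ∀ m, 1 ≤ m → m ≤ n → CodimGtOne ((f.iter m).image H)

/-- `H` is the primitive degree lowering hypersurface of `f` with height `n`: there are
hypersurfaces as in `IsPrimitiveComponent` of height `n`, and `H` is their union. -/
def IsPrimitive (f : DominatingMap k) (H : Set (ProjSpace k)) (n : ℕ) : Prop :=
  (∃ C, f.IsPrimitiveComponent C n) ∧ H = ⋃₀ {C | f.IsPrimitiveComponent C n}

/-- Quasi-algebraically stable maps. -/
def IsQAS (f : DominatingMap k) : Prop :=
  f.IsAS ∨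
  ∃ (H₀ : Set (ProjSpace k)) (n₀ : ℕ),
    (f.IsPrimitive H₀ n₀ ∧ ∀ H n, f.IsPrimitive H n → H = H₀ ∧ n = n₀) ∧
    (∀ C, IsComponentOf C H₀ → ∀ m, 1 ≤ m → m ≤ n₀ → ¬ (f.iter m).image C ⊆ H₀) ∧
    (∀ C, IsComponentOf C H₀ →
      (∀ m, n₀ + 1 ≤ m → ¬ (f.iter m).image C ⊆ f.indet) ∨
      (∃ m₀, n₀ ≤ m₀ ∧ IsHypersurface ((f.iter (m₀ + 1)).image C) ∧
        ∀ m, n₀ + 1 ≤ m → m ≤ m₀ → ¬ (f.iter m).image C ⊆ f.indet))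

/-- The first dynamical degree `λ₁(f) = lim d(f^n)^(1/n)`. -/
noncomputable def firstDynamicalDegree (f : DominatingMap k) : ℝ :=
  limUnder atTop fun n : ℕ => ((f.iter n).deg : ℝ) ^ (1 / (n : ℝ))

end DominatingMap

end ProjDyn

namespace ProjDyn

/-! Let `F`, `F_n` be liftings of `f`, `f^n`, and write `F ∘ F_n = h_n F_{n+1}`, where `h_n` is
`f.cofactor n`. Then `d(f^{n+1}) = d(f) d(f^n) - deg h_n`, and an irreducible `P` divides `h_n`
exactly when `f^n` sends `P = 0` into `I(f)`.

Quasi-algebraic stability determines every `h_n`: it is a unit for `n < n₀`, and `h_{n₀+j}` equals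
`h_{n₀} ∘ F_j` up to a unit (`associated_cofactor`). To see this, follow a factor `P = 0` of `h_n`
to the last hypersurface `S = f^a(P)` in its orbit up to time `n`. From `S` on the images have
codimension greater than 1, so `S` is a component of the primitive hypersurface; its first entry
into `I(f)` is at time `n₀`, and condition (iii) excludes a later entry before another hypersurface
is met. Hence `n - a = n₀`. Condition (ii) prevents `h_{n₀} ∘ F_j` from having further factors.

So `u_n = d(f^n)` satisfies `u_{n+1} = d u_n - h u_{n-n₀}` (without the last term for `n < n₀`). The
ratios `u_{n+1}/u_n` then decrease, and their limit is a root of the monic integer polynomial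
`X^{n₀+1} - d X^{n₀} + h`. Convergence of the ratios implies that of the `n`-th roots. -/

/-! ### Dimension theory through transcendence degree. -/

/-- The transcendence degree drops in a proper quotient of a domain. -/
theorem trdeg_lt_of_surjective_of_not_injective {K A B : Type} [Field K] [CommRing A] [CommRing B]
    [Algebra K A] [Algebra K B] [IsDomain A] [IsDomain B] (hA : Algebra.trdeg K A < Cardinal.aleph0)
    (φ : A →ₐ[K] B) (hφ : Function.Surjective φ) (hφ' : ¬ Function.Injective φ) :
    Algebra.trdeg K B < Algebra.trdeg K A := by
  by_contra! hle
  have heq : Algebra.trdeg K B = Algebra.trdeg K A :=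
    le_antisymm (trdeg_le_of_surjective φ hφ) hle
  obtain ⟨ι, y, hy⟩ := exists_isTranscendenceBasis' K B
  have hcard : Cardinal.mk ι = Algebra.trdeg K B := hy.cardinalMk_eq_trdeg
  have hfin : Finite ι := by
    rw [← Cardinal.lt_aleph0_iff_finite, hcard, heq]
    exact hA
  choose s hs using hφ
  -- A transcendence basis of `B` lifts to an independent family in `A`; equality of the finite
  -- transcendence degrees makes it a basis of `A`.
  have hx : AlgebraicIndependent K (s ∘ y) := by
    refine AlgebraicIndependent.of_comp φ ?_
    have : φ ∘ s ∘ y = y := funext fun i => hs (y i)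
    rw [this]
    exact hy.1
  have hbas : IsTranscendenceBasis K (s ∘ y) :=
    hx.isTranscendenceBasis_of_trdeg_le_of_finite (by rw [hcard, heq])
  have halg := hbas.isAlgebraic
  rw [← AlgHom.coe_toRingHom, injective_iff_map_eq_zero] at hφ'
  push Not at hφ'
  obtain ⟨a, ha, ha0⟩ := hφ'
  -- A nonzero element of the kernel divides a nonzero polynomial in the lifted basis, whose image
  -- is a relation between the `y i`.
  obtain ⟨r, hr0, hr⟩ := (halg.isAlgebraic a).exists_nonzero_dvd (mem_nonZeroDivisors_of_ne_zero ha0)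
  have hr' : φ (r : A) = 0 := by
    obtain ⟨c, hc⟩ := hr
    change (r : A) = a * c at hc
    rw [hc, map_mul, show φ a = 0 from ha, zero_mul]
  obtain ⟨p, hp⟩ := hx.aevalEquiv.surjective r
  have hp' : aeval (s ∘ y) p = (r : A) := by rw [← hp]; simp
  have h0 : aeval y p = 0 := by
    rw [← hr', ← hp', ← AlgHom.comp_apply, comp_aeval]
    congr 2
    exact funext fun i => (hs (y i)).symm
  have hp0 : p = 0 := hy.1 (by rw [h0, map_zero])
  exact hr0 (by rw [← hp, hp0, map_zero])

variable {k : ℕ}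

theorem trdeg_mvPolynomial_fin (n : ℕ) :
    Algebra.trdeg ℂ (MvPolynomial (Fin n) ℂ) = (n : Cardinal) := by
  rw [MvPolynomial.trdeg_of_isDomain, Cardinal.mk_fin, Cardinal.lift_natCast]

theorem isPrime_span_singleton {P : MvPolynomial (Fin (k + 1)) ℂ} (hP : Irreducible P) :
    (Ideal.span {P}).IsPrime :=
  (Ideal.span_singleton_prime hP.ne_zero).mpr hP.prime

theorem trdeg_quotient_lt {I : Ideal (MvPolynomial (Fin (k + 1)) ℂ)} [I.IsPrime] (hI : I ≠ ⊥) :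
    Algebra.trdeg ℂ (MvPolynomial (Fin (k + 1)) ℂ ⧸ I) < ((k + 1 : ℕ) : Cardinal) := by
  have hT := trdeg_mvPolynomial_fin (k + 1)
  refine lt_of_lt_of_eq (trdeg_lt_of_surjective_of_not_injective ?_ (Ideal.Quotient.mkₐ ℂ I)
    (Ideal.Quotient.mkₐ_surjective ℂ I) ?_) hT
  · rw [hT]; exact Cardinal.natCast_lt_aleph0
  · intro h
    refine hI ((Submodule.eq_bot_iff _).mpr fun x hx => h ?_)
    rw [map_zero]
    exact Ideal.Quotient.eq_zero_iff_mem.mpr hx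

/-- If the variable `X j` occurs in `S`, it occurs in all nonzero multiples of `S`, so the
polynomials in the other `k` variables inject into the quotient. -/
theorem le_trdeg_quotient_span {S : MvPolynomial (Fin (k + 1)) ℂ} (hS : Irreducible S) :
    (k : Cardinal) ≤ Algebra.trdeg ℂ (MvPolynomial (Fin (k + 1)) ℂ ⧸ Ideal.span {S}) := by
  classical
  obtain ⟨j, hj⟩ : ∃ j, degreeOf j S ≠ 0 := by
    by_contra! h
    have h0 : S.vars = ∅ := Finset.eq_empty_iff_forall_notMem.mpr fun j hjS =>
      mem_vars_iff_degreeOf_ne_zero.mp hjS (h j)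
    obtain ⟨r, hr⟩ : ∃ r, S = C r := ⟨_, (vars_eq_empty_iff_eq_C).mp h0⟩
    have hr0 : r ≠ 0 := fun h => hS.ne_zero (by rw [hr, h, C_0])
    exact hS.not_isUnit (by rw [hr]; exact (isUnit_iff_ne_zero.mpr hr0).map C)
  let e : MvPolynomial (Fin k) ℂ →ₐ[ℂ] MvPolynomial (Fin (k + 1)) ℂ := rename j.succAbove
  have hinj : Function.Injective ((Ideal.Quotient.mkₐ ℂ (Ideal.span {S})).comp e) := by
    rw [← AlgHom.coe_toRingHom, injective_iff_map_eq_zero]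
    intro q hq
    by_contra hq0
    have hdvd : S ∣ e q := by
      rw [← Ideal.mem_span_singleton]
      exact Ideal.Quotient.eq_zero_iff_mem.mp hq
    obtain ⟨T, hT⟩ := hdvd
    have heq0 : e q ≠ 0 := fun h =>
      hq0 (rename_injective _ Fin.succAbove_right_injective (by rw [map_zero]; exact h))
    have hT0 : T ≠ 0 := fun h => heq0 (by rw [hT, h, mul_zero])
    have h1 : degreeOf j (e q) = degreeOf j S + degreeOf j T := by
      rw [hT]; exact degreeOf_mul_eq hS.ne_zero hT0
    have h2 : degreeOf j (e q) = 0 := by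
      by_contra h
      obtain ⟨i, -, hi⟩ := mem_vars_rename _ _ (mem_vars_iff_degreeOf_ne_zero.mpr h)
      exact Fin.succAbove_ne j i hi
    omega
  rw [← trdeg_mvPolynomial_fin k]
  exact trdeg_le_of_injective _ hinj

/-- An irreducible hypersurface is not mapped dominantly to projective space. -/
theorem exists_ne_zero_dvd_map {P : MvPolynomial (Fin (k + 1)) ℂ} (hP : Irreducible P)
    (φ : MvPolynomial (Fin (k + 1)) ℂ →ₐ[ℂ] MvPolynomial (Fin (k + 1)) ℂ) :
    ∃ R, R ≠ 0 ∧ P ∣ φ R := by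
  by_contra! h
  have := isPrime_span_singleton hP
  have hinj : Function.Injective ((Ideal.Quotient.mkₐ ℂ (Ideal.span {P})).comp φ) := by
    rw [← AlgHom.coe_toRingHom, injective_iff_map_eq_zero]
    intro q hq
    by_contra hq0
    refine h q hq0 ?_
    rw [← Ideal.mem_span_singleton]
    exact Ideal.Quotient.eq_zero_iff_mem.mp hq
  have h1 := trdeg_le_of_injective _ hinj
  rw [trdeg_mvPolynomial_fin] at h1
  refine absurd (trdeg_quotient_lt (I := Ideal.span {P}) ?_) (not_lt.mpr h1)
  rw [Ne, Ideal.span_singleton_eq_bot]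
  exact hP.ne_zero

/-- If the image of a projective variety contains a hypersurface, the variety is contained in no
hypersurface other than itself. -/
theorem le_span_of_comap_le_span {I : Ideal (MvPolynomial (Fin (k + 1)) ℂ)} [I.IsPrime]
    (φ : MvPolynomial (Fin (k + 1)) ℂ →ₐ[ℂ] MvPolynomial (Fin (k + 1)) ℂ)
    {S R : MvPolynomial (Fin (k + 1)) ℂ} (hS : Irreducible S) (hR : Irreducible R)
    (hle : I.comap φ ≤ Ideal.span {S}) (hRI : R ∈ I) : I ≤ Ideal.span {R} := by
  have := isPrime_span_singleton hR
  have hRle : Ideal.span {R} ≤ I := by rwa [Ideal.span_singleton_le_iff_mem]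
  -- The coordinate ring of the image surjects onto that of `S = 0` and embeds into that of the
  -- source. If `I` were larger than `(R)`, its quotient would have transcendence degree less than
  -- `k`.
  have h1 : (k : Cardinal) ≤ Algebra.trdeg ℂ (MvPolynomial (Fin (k + 1)) ℂ ⧸ I) := by
    refine (le_trdeg_quotient_span hS).trans ?_
    refine (trdeg_le_of_surjective (Ideal.Quotient.factorₐ ℂ hle)
      (Ideal.Quotient.factor_surjective hle)).trans ?_
    exact trdeg_le_of_injective (Ideal.quotientMapₐ I φ le_rfl) (Ideal.quotientMap_injective)
  have h2 : Algebra.trdeg ℂ (MvPolynomial (Fin (k + 1)) ℂ ⧸ Ideal.span {R}) <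
      ((k + 1 : ℕ) : Cardinal) :=
    trdeg_quotient_lt (by rw [Ne, Ideal.span_singleton_eq_bot]; exact hR.ne_zero)
  by_contra hcon
  have h3 := trdeg_lt_of_surjective_of_not_injective (h2.trans Cardinal.natCast_lt_aleph0)
    (Ideal.Quotient.factorₐ ℂ hRle) (Ideal.Quotient.factor_surjective hRle) (by
      intro hinj
      refine hcon fun x hx => ?_
      rw [← Ideal.Quotient.eq_zero_iff_mem]
      apply hinj
      rw [map_zero]
      exact Ideal.Quotient.eq_zero_iff_mem.mpr hx)
  obtain ⟨n, hn⟩ := Cardinal.lt_aleph0.mp (h2.trans Cardinal.natCast_lt_aleph0)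
  rw [hn] at h2 h3
  have h5 := h1.trans_lt h3
  rw [Nat.cast_lt] at h2 h5
  omega

/-! ### Homogeneous polynomials and projective zero loci. -/

theorem isUnit_of_isHomogeneous_zero {P : MvPolynomial (Fin (k + 1)) ℂ} (h : P.IsHomogeneous 0)
    (h0 : P ≠ 0) : IsUnit P := by
  have hC := totalDegree_eq_zero_iff_eq_C.mp (Nat.le_zero.mp h.totalDegree_le)
  rw [hC] at h0 ⊢
  exact (isUnit_iff_ne_zero.mpr fun h => h0 (by rw [h, C_0])).map C

theorem exists_isHomogeneous_of_dvd {P Q : MvPolynomial (Fin (k + 1)) ℂ} {n : ℕ}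
    (h : Q.IsHomogeneous n) (hQ : Q ≠ 0) (hPQ : P ∣ Q) : ∃ m, P.IsHomogeneous m := by
  obtain ⟨T, rfl⟩ := hPQ
  obtain ⟨a, b, -, ha, -⟩ :=
    isHomogeneous_of_mul h (left_ne_zero_of_mul hQ) (right_ne_zero_of_mul hQ)
  exact ⟨a, ha⟩

theorem le_of_dvd_of_isHomogeneous {P Q : MvPolynomial (Fin (k + 1)) ℂ} {m n : ℕ}
    (hP : P.IsHomogeneous m) (hQ : Q.IsHomogeneous n) (hQ0 : Q ≠ 0) (h : P ∣ Q) : m ≤ n := by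
  obtain ⟨T, rfl⟩ := h
  have hP0 := left_ne_zero_of_mul hQ0
  obtain ⟨a, b, hab, ha, -⟩ := isHomogeneous_of_mul hQ hP0 (right_ne_zero_of_mul hQ0)
  have := hP.inj_right ha hP0
  omega

theorem eval_bind₁ (G : Fin (k + 1) → MvPolynomial (Fin (k + 1)) ℂ)
    (R : MvPolynomial (Fin (k + 1)) ℂ) (v : Fin (k + 1) → ℂ) :
    eval v (bind₁ G R) = eval (fun i => eval v (G i)) R := by
  simp only [← aeval_eq_eval, aeval_bind₁]

theorem eval_zero_of_isHomogeneous {R : MvPolynomial (Fin (k + 1)) ℂ} {n : ℕ}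
    (hR : R.IsHomogeneous n) (hn : 0 < n) : eval 0 R = 0 := by
  have : eval (0 : Fin (k + 1) → ℂ) R = constantCoeff R := by
    rw [constantCoeff_eq]; exact congrFun (congrArg _ (eval_zero' )) R
  rw [this]
  exact hR.coeff_eq_zero (by simpa using hn.ne)

theorem bind₁_mul_of_isHomogeneous {R : MvPolynomial (Fin (k + 1)) ℂ} {n : ℕ}
    (hR : R.IsHomogeneous n) (c : MvPolynomial (Fin (k + 1)) ℂ)
    (L : Fin (k + 1) → MvPolynomial (Fin (k + 1)) ℂ) :
    bind₁ (fun i => c * L i) R = c ^ n * bind₁ L R := by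
  simp only [bind₁, aeval_def, eval₂_eq', Finset.mul_sum]
  refine Finset.sum_congr rfl fun d hd => ?_
  have hd' : ∑ i, d i = n := by
    rw [← Finsupp.degree_eq_sum]
    by_contra h
    exact (mem_support_iff.mp hd) (hR.coeff_eq_zero h)
  simp only [mul_pow, Finset.prod_mul_distrib, Finset.prod_pow_eq_pow_sum, hd']
  ring

theorem homogeneousComponent_bind₁ {G : Fin (k + 1) → MvPolynomial (Fin (k + 1)) ℂ} {e : ℕ}
    (hG : ∀ i, (G i).IsHomogeneous e) (he : 0 < e) (R : MvPolynomial (Fin (k + 1)) ℂ) (n : ℕ) :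
    homogeneousComponent (e * n) (bind₁ G R) = bind₁ G (homogeneousComponent n R) := by
  induction R using MvPolynomial.induction_on' with
  | monomial m c =>
    have h1 : (monomial m c).IsHomogeneous m.degree := isHomogeneous_monomial c rfl
    have h2 : (bind₁ G (monomial m c)).IsHomogeneous (e * m.degree) := h1.aeval G hG
    rw [homogeneousComponent_of_mem h1, homogeneousComponent_of_mem h2]
    by_cases h : n = m.degree
    · simp [h]
    · rw [if_neg h, if_neg (fun h' => h (Nat.eq_of_mul_eq_mul_left he h')), map_zero]
  | add p q hp hq => simp only [map_add, hp, hq]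

theorem dvd_homogeneousComponent {P Q : MvPolynomial (Fin (k + 1)) ℂ} {m : ℕ}
    (hP : P.IsHomogeneous m) (h : P ∣ Q) (n : ℕ) : P ∣ homogeneousComponent n Q := by
  rw [← Ideal.mem_span_singleton] at h ⊢
  let := gradedAlgebra (σ := Fin (k + 1)) (R := ℂ)
  refine homogeneousComponent_mem_of_mem
    (Ideal.homogeneous_span (homogeneousSubmodule (Fin (k + 1)) ℂ) _ ?_) h n
  rintro x rfl
  exact ⟨m, hP⟩

/-- Images are defined through homogeneous polynomials only; this passes to arbitrary `R`. Since `e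
> 0`, distinct components of `R` are pulled back to distinct degrees. -/
theorem dvd_bind₁_iff_forall_homogeneousComponent {P : MvPolynomial (Fin (k + 1)) ℂ} {m : ℕ}
    (hP : P.IsHomogeneous m) {G : Fin (k + 1) → MvPolynomial (Fin (k + 1)) ℂ} {e : ℕ}
    (hG : ∀ i, (G i).IsHomogeneous e) (he : 0 < e) (R : MvPolynomial (Fin (k + 1)) ℂ) :
    P ∣ bind₁ G R ↔ ∀ n, P ∣ bind₁ G (homogeneousComponent n R) := by
  constructor
  · intro h n
    rw [← homogeneousComponent_bind₁ hG he]
    exact dvd_homogeneousComponent hP h _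
  · intro h
    rw [← sum_homogeneousComponent R, map_sum]
    exact Finset.dvd_sum fun i _ => h i

theorem dvd_of_forall_eval {P R : MvPolynomial (Fin (k + 1)) ℂ} (hP : Irreducible P)
    (h : ∀ v, eval v P = 0 → eval v R = 0) : P ∣ R := by
  have := isPrime_span_singleton hP
  rw [← Ideal.mem_span_singleton,
    ← IsPrime.vanishingIdeal_zeroLocus (K := ℂ) (Ideal.span {P})]
  rw [mem_vanishingIdeal_iff]
  intro x hx
  rw [zeroLocus_span] at hx
  rw [aeval_eq_eval]
  exact h x (by simpa using hx)

theorem mk_mem_zeroLocus {P : MvPolynomial (Fin (k + 1)) ℂ} {n : ℕ} (hP : P.IsHomogeneous n)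
    (v : Fin (k + 1) → ℂ) (hv : v ≠ 0) :
    Projectivization.mk ℂ v hv ∈ zeroLocus P ↔ eval v P = 0 := by
  refine ⟨fun h => h v hv rfl, fun h w hw hwv => ?_⟩
  obtain ⟨a, rfl⟩ := (Projectivization.mk_eq_mk_iff ℂ w v hw hv).mp hwv
  have hsmul : (a • v : Fin (k + 1) → ℂ) = fun i => eval v (C (a : ℂ) * X i) := by
    funext i; simp [Units.smul_def]
  rw [hsmul, ← eval_bind₁, bind₁_mul_of_isHomogeneous hP, map_mul]
  rw [show bind₁ (fun i => X i) P = P from aeval_X_left_apply P, h, mul_zero]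

theorem zeroLocus_subset_zeroLocus {P Q : MvPolynomial (Fin (k + 1)) ℂ} (h : P ∣ Q) :
    zeroLocus P ⊆ zeroLocus Q := by
  rintro p hp v hv hvp
  obtain ⟨T, rfl⟩ := h
  rw [map_mul, hp v hv hvp, zero_mul]

theorem exists_dvd_of_mem_zeroLocus {Q : MvPolynomial (Fin (k + 1)) ℂ} {n : ℕ}
    (hQ : Q.IsHomogeneous n) (hQ0 : Q ≠ 0) {p : ProjSpace k} (hp : p ∈ zeroLocus Q) :
    ∃ P, Irreducible P ∧ P ∣ Q ∧ p ∈ zeroLocus P := by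
  induction p using Projectivization.ind with | h v hv => ?_
  rw [mk_mem_zeroLocus hQ] at hp
  suffices H : ∃ P, Irreducible P ∧ P ∣ Q ∧ eval v P = 0 by
    obtain ⟨P, hP, hPQ, h⟩ := H
    obtain ⟨m, hm⟩ := exists_isHomogeneous_of_dvd hQ hQ0 hPQ
    exact ⟨P, hP, hPQ, (mk_mem_zeroLocus hm v hv).mpr h⟩
  clear hQ
  induction Q using WfDvdMonoid.induction_on_irreducible with
  | zero => exact absurd rfl hQ0
  | unit u hu =>
    have := hu.map (eval v)
    rw [hp] at this
    exact absurd this not_isUnit_zero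
  | mul a i ha hi ih =>
    rw [map_mul] at hp
    rcases mul_eq_zero.mp hp with h | h
    · exact ⟨i, hi, dvd_mul_right _ _, h⟩
    · obtain ⟨P, hP, hPa, h'⟩ := ih ha h
      exact ⟨P, hP, hPa.mul_left _, h'⟩

theorem exists_irreducible_dvd_of_dvd_map {P Q : MvPolynomial (Fin (k + 1)) ℂ}
    (hP : Irreducible P)
    (φ : MvPolynomial (Fin (k + 1)) ℂ →ₐ[ℂ] MvPolynomial (Fin (k + 1)) ℂ)
    (hQ0 : Q ≠ 0) (h : P ∣ φ Q) : ∃ R, Irreducible R ∧ R ∣ Q ∧ P ∣ φ R := by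
  induction Q using WfDvdMonoid.induction_on_irreducible with
  | zero => exact absurd rfl hQ0
  | unit u hu => exact absurd (isUnit_of_dvd_unit h (hu.map φ)) hP.not_isUnit
  | mul a i ha hi ih =>
    rw [map_mul] at h
    rcases hP.prime.dvd_or_dvd h with h | h
    · exact ⟨i, hi, dvd_mul_right _ _, h⟩
    · obtain ⟨R, hR, hRa, h'⟩ := ih ha h
      exact ⟨R, hR, hRa.mul_left _, h'⟩

/-- The polynomials `X i` have no nontrivial common factor. -/
theorem isUnit_of_forall_dvd_X (hk : 1 ≤ k) {P : MvPolynomial (Fin (k + 1)) ℂ}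
    (h : ∀ i, P ∣ X i) : IsUnit P :=
  (DominatingMap.ident hk).coprime P h

/-- This is the Nullstellensatz, except that the origin is not a projective point. It matters only
if `R` is a nonzero constant: then `P` would vanish at most at the origin and divide every variable.
-/
theorem dvd_of_zeroLocus_subset (hk : 1 ≤ k) {P R : MvPolynomial (Fin (k + 1)) ℂ} {m n : ℕ}
    (hP : Irreducible P) (hPm : P.IsHomogeneous m) (hR : R.IsHomogeneous n)
    (h : zeroLocus P ⊆ zeroLocus R) : P ∣ R := by
  have h' : ∀ v, v ≠ 0 → eval v P = 0 → eval v R = 0 := fun v hv hvP =>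
    (mk_mem_zeroLocus hR v hv).mp (h ((mk_mem_zeroLocus hPm v hv).mpr hvP))
  by_cases hn : 0 < n
  · refine dvd_of_forall_eval hP fun v hv => ?_
    rcases eq_or_ne v 0 with rfl | hv0
    · exact eval_zero_of_isHomogeneous hR hn
    · exact h' v hv0 hv
  · by_cases hR0 : R = 0
    · rw [hR0]; exact dvd_zero P
    obtain rfl : n = 0 := by omega
    exfalso
    refine hP.not_isUnit (isUnit_of_forall_dvd_X hk fun i => dvd_of_forall_eval hP fun v hv => ?_)
    rcases eq_or_ne v 0 with rfl | hv0
    · simp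
    · have := (isUnit_of_isHomogeneous_zero hR hR0).map (eval v)
      rw [h' v hv0 hv] at this
      exact absurd this not_isUnit_zero

theorem subset_algClosure (A : Set (ProjSpace k)) : A ⊆ algClosure A :=
  fun _ hq _ _ _ h => h hq

theorem isHypersurface_zeroLocus {S : MvPolynomial (Fin (k + 1)) ℂ} {n : ℕ} (hS : Irreducible S)
    (hSn : S.IsHomogeneous n) : IsHypersurface (zeroLocus S) := by
  refine ⟨S, n, hS.ne_zero, ?_, hSn, rfl⟩
  rcases Nat.eq_zero_or_pos n with rfl | h
  · exact absurd (isUnit_of_isHomogeneous_zero hSn hS.ne_zero) hS.not_isUnit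
  · exact h

theorem IsHypersurface.not_codimGtOne {A : Set (ProjSpace k)} (h : IsHypersurface A) :
    ¬ CodimGtOne A := fun h' => h' A h Set.Subset.rfl

/-! ### Images of irreducible hypersurfaces expressed by divisibility. -/

namespace DominatingMap

theorem deg_pos (f : DominatingMap k) : 0 < f.deg := by
  by_contra h
  have h0 : f.deg = 0 := by omega
  refine f.dominating ?_
  have : jacobianMatrix f.lift = 0 := by
    ext1 i j
    have hi := f.homog i
    rw [h0] at hi
    have := totalDegree_eq_zero_iff_eq_C.mp (Nat.le_zero.mp hi.totalDegree_le)
    simp only [jacobianMatrix, Matrix.of_apply, Matrix.zero_apply]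
    rw [this, pderiv_C]
  rw [this, Matrix.det_zero]

theorem exists_not_dvd (f : DominatingMap k) {P : MvPolynomial (Fin (k + 1)) ℂ}
    (hP : Irreducible P) : ∃ i, ¬ P ∣ f.lift i := by
  by_contra! h
  exact hP.not_isUnit (f.coprime P h)

/-- The components of a lifting are coprime, so the greatest common divisor of the `y * f.lift i` is
`y`. The prime factors of `x` are cancelled one at a time. -/
theorem dvd_of_forall_dvd_mul (f : DominatingMap k) {x y : MvPolynomial (Fin (k + 1)) ℂ}
    (hx : x ≠ 0) (h : ∀ i, x ∣ y * f.lift i) : x ∣ y := by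
  induction x using WfDvdMonoid.induction_on_irreducible generalizing y with
  | zero => exact absurd rfl hx
  | unit u hu => exact hu.dvd
  | mul a p ha hp ih =>
    obtain ⟨j, hj⟩ := f.exists_not_dvd hp
    obtain ⟨z, rfl⟩ := (hp.prime.dvd_or_dvd ((dvd_mul_right p a).trans (h j))).resolve_right hj
    refine mul_dvd_mul_left p (ih ha fun i => ?_)
    have := h i
    rw [mul_assoc] at this
    exact (mul_dvd_mul_iff_left hp.ne_zero).mp this

theorem isHomogeneous_bind₁ (f : DominatingMap k) {R : MvPolynomial (Fin (k + 1)) ℂ} {n : ℕ}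
    (hR : R.IsHomogeneous n) : (bind₁ f.lift R).IsHomogeneous (f.deg * n) :=
  hR.aeval f.lift f.homog

theorem eval_evalLift (f : DominatingMap k) (R : MvPolynomial (Fin (k + 1)) ℂ)
    (v : Fin (k + 1) → ℂ) : eval (f.evalLift v) R = eval v (bind₁ f.lift R) :=
  (eval_bind₁ _ _ _).symm

/-- Images of irreducible hypersurfaces in terms of divisibility. -/
theorem image_subset_zeroLocus_iff (f : DominatingMap k) {P R : MvPolynomial (Fin (k + 1)) ℂ}
    {m n : ℕ} (hP : Irreducible P) (hPm : P.IsHomogeneous m) (hR : R.IsHomogeneous n) :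
    f.image (zeroLocus P) ⊆ zeroLocus R ↔ P ∣ bind₁ f.lift R := by
  constructor
  · intro h
    have h1 : ∀ v (_ : v ≠ 0), eval v P = 0 → f.evalLift v ≠ 0 → eval v (bind₁ f.lift R) = 0 := by
      intro v hv hvP hw
      rw [← eval_evalLift]
      refine (mk_mem_zeroLocus hR _ hw).mp (h (subset_algClosure _ ?_))
      exact ⟨v, hv, hw, (mk_mem_zeroLocus hPm v hv).mpr hvP, rfl⟩
    by_cases hR0 : R = 0
    · rw [hR0, map_zero]; exact dvd_zero P
    rcases Nat.eq_zero_or_pos n with rfl | hn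
    · exfalso
      have hu := isUnit_of_isHomogeneous_zero hR hR0
      obtain ⟨i, hi⟩ := f.exists_not_dvd hP
      refine hi (dvd_of_zeroLocus_subset f.one_le_dim hP hPm (f.homog i) ?_)
      intro p hp v hv hvp
      by_contra hcon
      have := h1 v hv (hp v hv hvp) (fun h0 => hcon (congrFun h0 i))
      have h2 := (hu.map (bind₁ f.lift)).map (eval v)
      rw [this] at h2
      exact absurd h2 not_isUnit_zero
    · refine dvd_of_zeroLocus_subset f.one_le_dim hP hPm (f.isHomogeneous_bind₁ hR) ?_
      intro p hp v hv hvp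
      -- At points of `I(f)` the pullback of `R` vanishes anyway, because `R` has positive degree.
      by_cases hw : f.evalLift v = 0
      · rw [← eval_evalLift, hw, eval_zero_of_isHomogeneous hR hn]
      · exact h1 v hv (hp v hv hvp) hw
  · intro h q hq
    refine hq R n hR ?_
    rintro _ ⟨v, hv, hw, hvP, rfl⟩
    rw [mk_mem_zeroLocus hR, eval_evalLift]
    obtain ⟨T, hT⟩ := h
    rw [hT, map_mul, (mk_mem_zeroLocus hPm v hv).mp hvP, zero_mul]

theorem subset_image_iff (f : DominatingMap k) {P : MvPolynomial (Fin (k + 1)) ℂ} {m : ℕ}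
    (hP : Irreducible P) (hPm : P.IsHomogeneous m) (B : Set (ProjSpace k)) :
    B ⊆ f.image (zeroLocus P) ↔
      ∀ (R : MvPolynomial (Fin (k + 1)) ℂ) (n : ℕ), R.IsHomogeneous n → P ∣ bind₁ f.lift R →
        B ⊆ zeroLocus R := by
  constructor
  · intro h R n hR hPR
    exact h.trans ((f.image_subset_zeroLocus_iff hP hPm hR).mpr hPR)
  · intro h q hq R n hR hA
    refine h R n hR ((f.image_subset_zeroLocus_iff hP hPm hR).mp ?_) hq
    exact fun q' hq' => hq' R n hR hA

/-- `f` maps the irreducible hypersurface `P = 0` onto the irreducible hypersurface `S = 0`. -/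
def MapsOnto (f : DominatingMap k) (P S : MvPolynomial (Fin (k + 1)) ℂ) : Prop :=
  Irreducible S ∧ (∃ n, S.IsHomogeneous n) ∧ ∀ R, P ∣ bind₁ f.lift R ↔ S ∣ R

theorem MapsOnto.image_eq {f : DominatingMap k} {P S : MvPolynomial (Fin (k + 1)) ℂ} {m : ℕ}
    (hP : Irreducible P) (hPm : P.IsHomogeneous m) (h : f.MapsOnto P S) :
    f.image (zeroLocus P) = zeroLocus S := by
  obtain ⟨hS, ⟨n, hn⟩, h⟩ := h
  apply Set.Subset.antisymm
  · exact (f.image_subset_zeroLocus_iff hP hPm hn).mpr ((h S).mpr dvd_rfl)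
  · exact (f.subset_image_iff hP hPm _).mpr fun R _ _ hPR =>
      zeroLocus_subset_zeroLocus ((h R).mp hPR)

theorem exists_irreducible_dvd_bind₁ (f : DominatingMap k) {P : MvPolynomial (Fin (k + 1)) ℂ}
    {m : ℕ} (hP : Irreducible P) (hPm : P.IsHomogeneous m) :
    ∃ R n, Irreducible R ∧ R.IsHomogeneous n ∧ P ∣ bind₁ f.lift R := by
  obtain ⟨R, hR0, hR⟩ := exists_ne_zero_dvd_map hP (bind₁ f.lift)
  obtain ⟨n, hn⟩ : ∃ n, homogeneousComponent n R ≠ 0 := by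
    by_contra! h
    exact hR0 (by rw [← sum_homogeneousComponent R]; exact Finset.sum_eq_zero fun i _ => h i)
  have h1 := (dvd_bind₁_iff_forall_homogeneousComponent hPm f.homog f.deg_pos R).mp hR n
  obtain ⟨Q, hQ, hQR, hPQ⟩ := exists_irreducible_dvd_of_dvd_map hP _ hn h1
  obtain ⟨l, hl⟩ :=
    exists_isHomogeneous_of_dvd (homogeneousComponent_isHomogeneous n R) hn hQR
  exact ⟨Q, l, hQ, hl, hPQ⟩

/-- If the image contains `S = 0`, then `S` divides every equation of the image. Some equation is
irreducible, hence associated to `S`, so `S` generates them all. -/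
theorem not_codimGtOne_image_iff (f : DominatingMap k) {P : MvPolynomial (Fin (k + 1)) ℂ}
    {m : ℕ} (hP : Irreducible P) (hPm : P.IsHomogeneous m) :
    ¬ CodimGtOne (f.image (zeroLocus P)) ↔ ∃ S, f.MapsOnto P S := by
  constructor
  · intro h
    simp only [CodimGtOne, not_forall, not_not] at h
    obtain ⟨_, ⟨T, n, hT0, hn, hTn, rfl⟩, hsub⟩ := h
    have hTu : ¬ IsUnit T := by
      intro hu
      have h0 := hu.map (eval (0 : Fin (k + 1) → ℂ))
      rw [eval_zero_of_isHomogeneous hTn hn] at h0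
      exact absurd h0 not_isUnit_zero
    obtain ⟨S, hS, hST⟩ := WfDvdMonoid.exists_irreducible_factor hTu hT0
    obtain ⟨l, hl⟩ := exists_isHomogeneous_of_dvd hTn hT0 hST
    have hsub' := (zeroLocus_subset_zeroLocus hST).trans hsub
    rw [f.subset_image_iff hP hPm] at hsub'
    have hdvd : ∀ R, P ∣ bind₁ f.lift R → S ∣ R := by
      intro R hR
      rw [dvd_bind₁_iff_forall_homogeneousComponent hPm f.homog f.deg_pos] at hR
      rw [← sum_homogeneousComponent R]
      refine Finset.dvd_sum fun i _ => ?_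
      have hi := homogeneousComponent_isHomogeneous i R
      exact dvd_of_zeroLocus_subset f.one_le_dim hS hl hi (hsub' _ i hi (hR i))
    refine ⟨S, hS, ⟨l, hl⟩, fun R => ⟨hdvd R, fun hSR => ?_⟩⟩
    obtain ⟨R₀, -, hR₀, -, hPR₀⟩ := f.exists_irreducible_dvd_bind₁ hP hPm
    have hass := (hS.associated_of_dvd hR₀ (hdvd R₀ hPR₀)).symm.dvd
    exact hPR₀.trans (map_dvd _ (hass.trans hSR))
  · rintro ⟨S, h⟩
    rw [h.image_eq hP hPm]
    exact (isHypersurface_zeroLocus h.1 h.2.1.choose_spec).not_codimGtOne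

/-! ### Hypersurfaces under composition of maps. -/

/-- If `h = g ∘ f` and `f(P = 0)` is not contained in `I(g)`, then `f(P = 0)` is a hypersurface as
soon as `h(P = 0)` is one. -/
theorem MapsOnto.of_comp {g f h : DominatingMap k} {c P S : MvPolynomial (Fin (k + 1)) ℂ} {m : ℕ}
    (hP : Irreducible P) (hPm : P.IsHomogeneous m)
    (hc : ∀ i, bind₁ f.lift (g.lift i) = c * h.lift i) (hPc : ¬ P ∣ c) (hS : h.MapsOnto P S) :
    ∃ T, f.MapsOnto P T := by
  have := isPrime_span_singleton hP
  obtain ⟨R, n, hR, hRn, hPR⟩ := f.exists_irreducible_dvd_bind₁ hP hPm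
  have hle : ((Ideal.span {P}).comap (bind₁ f.lift)).comap (bind₁ g.lift) ≤ Ideal.span {S} := by
    intro Q hQ
    rw [Ideal.mem_comap, Ideal.mem_comap, Ideal.mem_span_singleton, bind₁_bind₁] at hQ
    rw [dvd_bind₁_iff_forall_homogeneousComponent hPm
      (fun i => f.isHomogeneous_bind₁ (g.homog i)) (Nat.mul_pos f.deg_pos g.deg_pos)] at hQ
    rw [Ideal.mem_span_singleton, ← hS.2.2,
      dvd_bind₁_iff_forall_homogeneousComponent hPm h.homog h.deg_pos]
    intro i
    have := hQ i
    simp only [hc] at this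
    rw [bind₁_mul_of_isHomogeneous (homogeneousComponent_isHomogeneous i Q)] at this
    exact (hP.prime.dvd_or_dvd this).resolve_left fun h' => hPc (hP.prime.dvd_of_dvd_pow h')
  -- The comap of `(P)` is the ideal of `f(P = 0)`. Its image under `g` contains the hypersurface `S
  -- = 0`, so it has dimension at least `k - 1` and fills the hypersurface `R = 0` containing it.
  have hmain := le_span_of_comap_le_span (I := (Ideal.span {P}).comap (bind₁ f.lift))
    (bind₁ g.lift) hS.1 hR hle (by rwa [Ideal.mem_comap, Ideal.mem_span_singleton])
  refine ⟨R, hR, ⟨n, hRn⟩, fun Q => ⟨fun hQ => ?_, fun hQ => hPR.trans (map_dvd _ hQ)⟩⟩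
  rw [← Ideal.mem_span_singleton]
  exact hmain (by rwa [Ideal.mem_comap, Ideal.mem_span_singleton])

/-- If `P` divided `c`, the hypersurface `S = 0` would lie in `I(g)`, whose codimension is at least
2. -/
theorem MapsOnto.not_dvd {g f h : DominatingMap k} {c P S : MvPolynomial (Fin (k + 1)) ℂ}
    (hc : ∀ i, bind₁ f.lift (g.lift i) = c * h.lift i) (hS : f.MapsOnto P S) : ¬ P ∣ c := by
  intro hPc
  obtain ⟨i, hi⟩ := g.exists_not_dvd hS.1
  exact hi ((hS.2.2 _).mp (by rw [hc]; exact hPc.mul_right _))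

/-- This is `g(f(P = 0)) = h(P = 0)`. It holds because the removed factor `c` does not vanish on `P
= 0`. -/
theorem MapsOnto.dvd_bind₁_iff {g f h : DominatingMap k} {c P S : MvPolynomial (Fin (k + 1)) ℂ}
    {m : ℕ} (hP : Irreducible P) (hPm : P.IsHomogeneous m)
    (hc : ∀ i, bind₁ f.lift (g.lift i) = c * h.lift i) (hS : f.MapsOnto P S)
    (R : MvPolynomial (Fin (k + 1)) ℂ) : S ∣ bind₁ g.lift R ↔ P ∣ bind₁ h.lift R := by
  obtain ⟨n, hn⟩ := hS.2.1
  rw [dvd_bind₁_iff_forall_homogeneousComponent hn g.homog g.deg_pos,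
    dvd_bind₁_iff_forall_homogeneousComponent hPm h.homog h.deg_pos]
  refine forall_congr' fun i => ?_
  rw [← hS.2.2, bind₁_bind₁]
  simp only [hc]
  rw [bind₁_mul_of_isHomogeneous (homogeneousComponent_isHomogeneous i R)]
  refine ⟨fun h' => ?_, fun h' => h'.mul_left _⟩
  exact (hP.prime.dvd_or_dvd h').resolve_left fun h' =>
    hS.not_dvd hc (hP.prime.dvd_of_dvd_pow h')

theorem MapsOnto.comp_iff {g f h : DominatingMap k} {c P S T : MvPolynomial (Fin (k + 1)) ℂ}
    {m : ℕ} (hP : Irreducible P) (hPm : P.IsHomogeneous m)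
    (hc : ∀ i, bind₁ f.lift (g.lift i) = c * h.lift i) (hS : f.MapsOnto P S) :
    g.MapsOnto S T ↔ h.MapsOnto P T := by
  simp only [MapsOnto, hS.dvd_bind₁_iff hP hPm hc]

/-! ### Liftings of the iterates and the factors removed from them. -/

/-- Composition of liftings of iterates. -/
theorem exists_iter_comp_iter (f : DominatingMap k) (a b : ℕ) :
    ∃ c, c ≠ 0 ∧
      ∀ i, bind₁ (f.iter b).lift ((f.iter a).lift i) = c * (f.iter (a + b)).lift i := by
  induction b with
  | zero =>
    refine ⟨1, one_ne_zero, fun i => ?_⟩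
    rw [one_mul]
    exact aeval_X_left_apply _
  | succ b ih =>
    obtain ⟨c, hc0, hc⟩ := ih
    obtain ⟨u, hu0, hu⟩ := comp_spec (f.iter b) f
    obtain ⟨w, hw0, hw⟩ := comp_spec (f.iter (a + b)) f
    have key : ∀ i, u ^ (f.iter a).deg * bind₁ (f.iter (b + 1)).lift ((f.iter a).lift i) =
        bind₁ f.lift c * w * (f.iter (a + (b + 1))).lift i := by
      intro i
      rw [← bind₁_mul_of_isHomogeneous ((f.iter a).homog i)]
      have : (fun i => u * (f.iter (b + 1)).lift i) =
          fun i => bind₁ f.lift ((f.iter b).lift i) := funext fun i => (hu i).symm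
      rw [this, ← bind₁_bind₁, hc, map_mul, hw, mul_assoc]
      rfl
    -- The factor `u` removed in forming `f^{b+1}` can be cancelled, because the lifting of
    -- `f^{a+b+1}` has coprime components.
    have hdvd : u ^ (f.iter a).deg ∣ bind₁ f.lift c * w :=
      (f.iter (a + (b + 1))).dvd_of_forall_dvd_mul (pow_ne_zero _ hu0) fun i =>
        Dvd.intro _ (key i)
    obtain ⟨e, he⟩ := hdvd
    refine ⟨e, ?_, fun i => ?_⟩
    · rintro rfl
      rw [mul_zero] at he
      exact mul_ne_zero (bind₁_ne_zero f.dominating hc0) hw0 he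
    · have := key i
      rw [he, mul_assoc] at this
      exact mul_left_cancel₀ (pow_ne_zero _ hu0) this

theorem exists_lift_ne_zero (f : DominatingMap k) : ∃ i, f.lift i ≠ 0 := by
  by_contra! h
  exact not_isUnit_zero (f.coprime 0 fun i => by rw [h i])

theorem exists_cofactor (f : DominatingMap k) (n : ℕ) :
    ∃ g, g ≠ 0 ∧
      ∀ i, bind₁ (f.iter n).lift (f.lift i) = g * (f.iter (n + 1)).lift i := by
  obtain ⟨H, hH0, hH⟩ := comp_spec (f.iter 0) f
  -- Iterates are defined as `f^n ∘ f`, while the degree recursion needs `f ∘ f^n`.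
  obtain ⟨c, hc0, hc⟩ := f.exists_iter_comp_iter 1 n
  refine ⟨bind₁ (f.iter n).lift H * c,
    mul_ne_zero (bind₁_ne_zero (f.iter n).dominating hH0) hc0, fun i => ?_⟩
  have h1 : f.lift i = H * (f.iter 1).lift i := (bind₁_X_right f.lift i).symm.trans (hH i)
  rw [h1, map_mul, hc, add_comm 1 n, mul_assoc]

/-- The greatest common factor of the components of the composite of the liftings of `f` and
`f^n`. -/
noncomputable def cofactor (f : DominatingMap k) (n : ℕ) : MvPolynomial (Fin (k + 1)) ℂ :=
  (f.exists_cofactor n).choose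

theorem cofactor_ne_zero (f : DominatingMap k) (n : ℕ) : f.cofactor n ≠ 0 :=
  (f.exists_cofactor n).choose_spec.1

theorem bind₁_iter_lift (f : DominatingMap k) (n : ℕ) (i : Fin (k + 1)) :
    bind₁ (f.iter n).lift (f.lift i) = f.cofactor n * (f.iter (n + 1)).lift i :=
  (f.exists_cofactor n).choose_spec.2 i

theorem exists_isHomogeneous_cofactor (f : DominatingMap k) (n : ℕ) :
    ∃ e, (f.cofactor n).IsHomogeneous e ∧ f.deg * (f.iter n).deg = e + (f.iter (n + 1)).deg := by
  obtain ⟨i, hi⟩ := (f.iter (n + 1)).exists_lift_ne_zero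
  have h := (f.iter n).isHomogeneous_bind₁ (f.homog i)
  rw [bind₁_iter_lift] at h
  obtain ⟨a, b, hab, ha, hb⟩ := isHomogeneous_of_mul h (f.cofactor_ne_zero n) hi
  refine ⟨a, ha, ?_⟩
  rw [((f.iter (n + 1)).homog i).inj_right hb hi, hab, mul_comm]

/-- The right-hand side says that `f^n` maps `P = 0` into `I(f)`; the components of the lifting of
`f^{n+1}` share no factor that could account for it. -/
theorem dvd_cofactor_iff (f : DominatingMap k) (n : ℕ) {P : MvPolynomial (Fin (k + 1)) ℂ}
    (hP : Irreducible P) :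
    P ∣ f.cofactor n ↔ ∀ i, P ∣ bind₁ (f.iter n).lift (f.lift i) := by
  simp only [bind₁_iter_lift]
  refine ⟨fun h i => h.mul_right _, fun h => ?_⟩
  obtain ⟨i, hi⟩ := (f.iter (n + 1)).exists_not_dvd hP
  exact (hP.prime.dvd_or_dvd (h i)).resolve_right hi

theorem not_dvd_cofactor_zero (f : DominatingMap k) {P : MvPolynomial (Fin (k + 1)) ℂ}
    (hP : Irreducible P) : ¬ P ∣ f.cofactor 0 := by
  rw [dvd_cofactor_iff _ _ hP]
  push Not
  obtain ⟨i, hi⟩ := f.exists_not_dvd hP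
  exact ⟨i, fun h => hi (by rwa [show bind₁ (f.iter 0).lift (f.lift i) = f.lift i from
    aeval_X_left_apply _] at h)⟩

/-- The image of the hypersurface `P = 0` under `f^n` is a hypersurface. -/
def IterMapsOnto (f : DominatingMap k) (n : ℕ) (P : MvPolynomial (Fin (k + 1)) ℂ) : Prop :=
  ∃ S, (f.iter n).MapsOnto P S

section

variable {f : DominatingMap k} {P S : MvPolynomial (Fin (k + 1)) ℂ} {l a n : ℕ}

theorem mapsOnto_iter_zero (hP : Irreducible P) (hPl : P.IsHomogeneous l) :
    (f.iter 0).MapsOnto P P :=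
  ⟨hP, ⟨l, hPl⟩, fun R => by
    rw [show bind₁ (f.iter 0).lift R = R from aeval_X_left_apply _]⟩

theorem MapsOnto.dvd_bind₁_iter_iff (hP : Irreducible P) (hPl : P.IsHomogeneous l)
    (hS : (f.iter a).MapsOnto P S) (m : ℕ) (R : MvPolynomial (Fin (k + 1)) ℂ) :
    S ∣ bind₁ (f.iter m).lift R ↔ P ∣ bind₁ (f.iter (m + a)).lift R := by
  obtain ⟨c, -, hc⟩ := f.exists_iter_comp_iter m a
  exact hS.dvd_bind₁_iff hP hPl hc R

theorem MapsOnto.dvd_cofactor_iff (hP : Irreducible P) (hPl : P.IsHomogeneous l)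
    (hS : (f.iter a).MapsOnto P S) (m : ℕ) : S ∣ f.cofactor m ↔ P ∣ f.cofactor (m + a) := by
  rw [f.dvd_cofactor_iff _ hS.1, f.dvd_cofactor_iff _ hP]
  exact forall_congr' fun i => hS.dvd_bind₁_iter_iff hP hPl m _

theorem MapsOnto.iterMapsOnto_iff (hP : Irreducible P) (hPl : P.IsHomogeneous l)
    (hS : (f.iter a).MapsOnto P S) (m : ℕ) :
    f.IterMapsOnto m S ↔ f.IterMapsOnto (m + a) P := by
  obtain ⟨c, -, hc⟩ := f.exists_iter_comp_iter m a
  exact exists_congr fun T => hS.comp_iff hP hPl hc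

/-- As long as the orbit stays out of `I(f)`, a further application of `f` cannot raise the
dimension. -/
theorem IterMapsOnto.of_succ (hP : Irreducible P) (hPl : P.IsHomogeneous l)
    (h : ¬ P ∣ f.cofactor n) (hn : f.IterMapsOnto (n + 1) P) : f.IterMapsOnto n P :=
  hn.choose_spec.of_comp hP hPl (f.bind₁_iter_lift n) h

/-- The last hypersurface in the orbit of `P = 0` up to time `n`. -/
theorem exists_last_mapsOnto (f : DominatingMap k) (hP : Irreducible P) (hPl : P.IsHomogeneous l)
    (n : ℕ) : ∃ a ≤ n, ∃ S, (f.iter a).MapsOnto P S ∧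
      ∀ m, 1 ≤ m → m + a ≤ n → ¬ f.IterMapsOnto m S := by
  induction n with
  | zero => exact ⟨0, le_rfl, P, mapsOnto_iter_zero hP hPl, fun m h1 h2 => by omega⟩
  | succ n ih =>
    by_cases h : f.IterMapsOnto (n + 1) P
    · obtain ⟨S, hS⟩ := h
      exact ⟨n + 1, le_rfl, S, hS, fun m h1 h2 => by omega⟩
    · obtain ⟨a, ha, S, hS, hlast⟩ := ih
      refine ⟨a, by omega, S, hS, fun m h1 h2 h3 => ?_⟩
      rcases Nat.lt_or_ge (m + a) (n + 1) with h4 | h4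
      · exact hlast m h1 (by omega) h3
      · rw [hS.iterMapsOnto_iff hP hPl, show m + a = n + 1 by omega] at h3
        exact h h3

/-- Comparison of the factors removed from the liftings of the iterates of `f`. -/
theorem bind₁_cofactor_mul (f : DominatingMap k) {i j : ℕ} {c c' : MvPolynomial (Fin (k + 1)) ℂ}
    (hc : ∀ s, bind₁ (f.iter j).lift ((f.iter i).lift s) = c * (f.iter (i + j)).lift s)
    (hc' : ∀ s, bind₁ (f.iter j).lift ((f.iter (i + 1)).lift s) =
      c' * (f.iter (i + 1 + j)).lift s) :
    bind₁ (f.iter j).lift (f.cofactor i) * c' = c ^ f.deg * f.cofactor (i + j) := by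
  obtain ⟨s, hs⟩ := (f.iter (i + j + 1)).exists_lift_ne_zero
  apply mul_right_cancel₀ hs
  -- The composite of the liftings of `f`, `f^i` and `f^j` is reduced in two ways, according to the
  -- grouping.
  have h1 := congrArg (bind₁ (f.iter j).lift) (f.bind₁_iter_lift i s)
  rw [map_mul, hc', bind₁_bind₁] at h1
  simp only [hc] at h1
  rw [bind₁_mul_of_isHomogeneous (f.homog s), bind₁_iter_lift,
    show i + 1 + j = i + j + 1 by omega] at h1
  rw [mul_assoc, ← h1, mul_assoc]

/-- With `F_i ∘ F_j = c_i F_{i+j}`, the identity `(h_i ∘ F_j) c_{i+1} = c_i^d h_{i+j}` carries `P ∤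
c_i` to `P ∤ c_{i+1}`, starting from `c_0`. -/
theorem not_dvd_bind₁_cofactor {j n : ℕ} (hP : Irreducible P)
    (h : ∀ i ≤ n, ¬ P ∣ f.cofactor (i + j)) : ¬ P ∣ bind₁ (f.iter j).lift (f.cofactor n) := by
  choose c hc0 hc using fun i => f.exists_iter_comp_iter i j
  have hstep : ∀ i ≤ n, ¬ P ∣ c i →
      ¬ P ∣ bind₁ (f.iter j).lift (f.cofactor i) * c (i + 1) := by
    intro i hi hci
    rw [f.bind₁_cofactor_mul (hc i) (hc (i + 1))]
    intro hd
    rcases hP.prime.dvd_or_dvd hd with hd | hd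
    · exact hci (hP.prime.dvd_of_dvd_pow hd)
    · exact h i hi hd
  have hci : ∀ i ≤ n, ¬ P ∣ c i := by
    intro i
    induction i with
    | zero =>
      intro _ hd
      obtain ⟨s, hs⟩ := (f.iter j).exists_not_dvd hP
      refine hs ?_
      have := hc 0 s
      rw [show (f.iter 0).lift s = X s from rfl, bind₁_X_right] at this
      rw [this]
      exact hd.mul_right _
    | succ i ih => exact fun hi hd => hstep i (by omega) (ih (by omega)) (hd.mul_left _)
  exact fun hd => hstep n le_rfl (hci n le_rfl) (hd.mul_right _)

end

/-! ### The cofactors of a quasi-algebraically stable map. -/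

/-- The algebraic content of quasi-algebraic stability: `n₀` is the height of the only primitive
degree lowering hypersurface, and `K P` says that `P = 0` is one of its components. -/
structure IsQuasiStable (f : DominatingMap k) (n₀ : ℕ)
    (K : MvPolynomial (Fin (k + 1)) ℂ → Prop) : Prop where
  height : ∀ P l t, Irreducible P → P.IsHomogeneous l → 1 ≤ t → P ∣ f.cofactor t →
    (∀ s, 1 ≤ s → s < t → ¬ P ∣ f.cofactor s) →
    (∀ m, 1 ≤ m → m ≤ t → ¬ f.IterMapsOnto m P) → t = n₀ ∧ K P
  not_dvd : ∀ P l m Q e, Irreducible P → P.IsHomogeneous l → K P → 1 ≤ m → m ≤ n₀ → Q ≠ 0 →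
    Q.IsHomogeneous e → (∀ R, Irreducible R → R ∣ Q → K R) → ¬ P ∣ bind₁ (f.iter m).lift Q
  orbit : ∀ P l, Irreducible P → P.IsHomogeneous l → K P →
    (∀ m, n₀ + 1 ≤ m → ¬ P ∣ f.cofactor m) ∨
    ∃ m₀, n₀ ≤ m₀ ∧ f.IterMapsOnto (m₀ + 1) P ∧
      ∀ m, n₀ + 1 ≤ m → m ≤ m₀ → ¬ P ∣ f.cofactor m

namespace IsQuasiStable

variable {f : DominatingMap k} {n₀ : ℕ} {K : MvPolynomial (Fin (k + 1)) ℂ → Prop}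
  {P : MvPolynomial (Fin (k + 1)) ℂ} {l : ℕ}

/-- The first time `P` divides a cofactor is a height, with no hypersurface among the images so far;
hence it is `n₀`. -/
theorem le_height (hf : f.IsQuasiStable n₀ K) (hP : Irreducible P) (hPl : P.IsHomogeneous l)
    {t : ℕ} (ht : 1 ≤ t) (hd : P ∣ f.cofactor t)
    (hh : ∀ m, 1 ≤ m → m ≤ t → ¬ f.IterMapsOnto m P) : n₀ ≤ t ∧ K P := by
  classical
  have hex : ∃ s, 1 ≤ s ∧ P ∣ f.cofactor s := ⟨t, ht, hd⟩
  have hle : Nat.find hex ≤ t := Nat.find_min' hex ⟨ht, hd⟩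
  obtain ⟨h1, h2⟩ := hf.height P l (Nat.find hex) hP hPl (Nat.find_spec hex).1
    (Nat.find_spec hex).2 (fun s hs1 hs2 hs => Nat.find_min hex hs2 ⟨hs1, hs⟩)
    (fun m hm1 hm2 => hh m hm1 (hm2.trans hle))
  exact ⟨h1 ▸ hle, h2⟩

/-- A component of the primitive hypersurface that enters the indeterminacy locus again after the
time `n₀` has met a hypersurface in between. -/
theorem exists_iterMapsOnto (hf : f.IsQuasiStable n₀ K) (hP : Irreducible P)
    (hPl : P.IsHomogeneous l) (hK : K P) {t : ℕ} (ht : n₀ + 1 ≤ t) (hd : P ∣ f.cofactor t) :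
    ∃ m, 1 ≤ m ∧ m ≤ t ∧ f.IterMapsOnto m P := by
  rcases hf.orbit P l hP hPl hK with h | ⟨m₀, -, h1, h2⟩
  · exact absurd hd (h t ht)
  · refine ⟨m₀ + 1, by omega, ?_, h1⟩
    by_contra hcon
    exact h2 t ht (by omega) hd

/-- The last hypersurface in the orbit is a primitive component that lies in `I(f)` after the
remaining time. By condition (iii) this remaining time is exactly `n₀`. -/
theorem exists_mapsOnto_of_dvd_cofactor (hf : f.IsQuasiStable n₀ K) (hP : Irreducible P)
    (hPl : P.IsHomogeneous l) {n : ℕ} (hd : P ∣ f.cofactor n) :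
    n₀ ≤ n ∧ f.IterMapsOnto (n - n₀) P := by
  obtain ⟨a, ha, S, hS, hlast⟩ := f.exists_last_mapsOnto hP hPl n
  obtain ⟨l', hl'⟩ := hS.2.1
  have hSd : S ∣ f.cofactor (n - a) := by
    rwa [hS.dvd_cofactor_iff hP hPl, show n - a + a = n by omega]
  have han : 1 ≤ n - a := by
    by_contra h
    rw [show n - a = 0 by omega] at hSd
    exact f.not_dvd_cofactor_zero hS.1 hSd
  have hlast' : ∀ m, 1 ≤ m → m ≤ n - a → ¬ f.IterMapsOnto m S := fun m h1 h2 =>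
    hlast m h1 (by omega)
  obtain ⟨hle, hK⟩ := hf.le_height hS.1 hl' han hSd hlast'
  have heq : n - a = n₀ := by
    by_contra hne
    obtain ⟨m, h1, h2, h3⟩ := hf.exists_iterMapsOnto hS.1 hl' hK (by omega) hSd
    exact hlast' m h1 h2 h3
  exact ⟨by omega, S, by rwa [show n - n₀ = a by omega]⟩

/-- A hypersurface met at a time `a > 0` would have to enter `I(f)` within `n₀ - a < n₀` steps,
against `le_height`. -/
theorem component_of_dvd_cofactor (hf : f.IsQuasiStable n₀ K) (hP : Irreducible P)
    (hPl : P.IsHomogeneous l) (hd : P ∣ f.cofactor n₀) : K P := by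
  have hn₀ : 1 ≤ n₀ := by
    by_contra h
    rw [show n₀ = 0 by omega] at hd
    exact f.not_dvd_cofactor_zero hP hd
  refine (hf.le_height hP hPl hn₀ hd fun m h1 h2 h3 => ?_).2
  obtain ⟨a, ha, S, hS, hlast⟩ := f.exists_last_mapsOnto hP hPl n₀
  obtain ⟨l', hl'⟩ := hS.2.1
  have hSd : S ∣ f.cofactor (n₀ - a) := by
    rwa [hS.dvd_cofactor_iff hP hPl, Nat.sub_add_cancel ha]
  have ha' : n₀ - a ≠ 0 := fun h => f.not_dvd_cofactor_zero hS.1 (h ▸ hSd)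
  have hle := (hf.le_height hS.1 hl' (Nat.one_le_iff_ne_zero.mpr ha') hSd
    fun m h1 h2 => hlast m h1 (by omega)).1
  obtain rfl : a = 0 := by omega
  exact hlast m h1 h2 ((hS.iterMapsOnto_iff hP hPl m).mpr h3)

/-- The only place where condition (ii) enters: it rules out that `f^b` maps `S`, the last
hypersurface of the orbit, into `h_{n₀} = 0` for some `1 ≤ b ≤ n₀`. -/
theorem dvd_cofactor_of_dvd_bind₁ (hf : f.IsQuasiStable n₀ K) (hP : Irreducible P)
    (hPl : P.IsHomogeneous l) {j : ℕ} (hd : P ∣ bind₁ (f.iter j).lift (f.cofactor n₀)) :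
    P ∣ f.cofactor (n₀ + j) := by
  by_contra hcon
  obtain ⟨a, ha, S, hS, hlast⟩ := f.exists_last_mapsOnto hP hPl j
  obtain ⟨l', hl'⟩ := hS.2.1
  obtain ⟨b, rfl⟩ := Nat.exists_eq_add_of_le' ha
  rw [← hS.dvd_bind₁_iter_iff hP hPl] at hd
  rw [← add_assoc, ← hS.dvd_cofactor_iff hP hPl] at hcon
  rcases Nat.eq_zero_or_pos b with rfl | hb
  · rw [show bind₁ (f.iter 0).lift (f.cofactor n₀) = f.cofactor n₀ from aeval_X_left_apply _] at hd
    exact hcon hd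
  classical
  -- If `f^{i+b}(S)` never lay in `I(f)`, nothing divisible by `S` could appear in `h_{n₀} ∘ F_b`.
  have hex : ∃ i, S ∣ f.cofactor (i + b) := by
    by_contra! h
    exact not_dvd_bind₁_cofactor hS.1 (fun i _ => h i) hd
  have hi := Nat.find_spec hex
  have hmin : ∀ i' < Nat.find hex, ¬ S ∣ f.cofactor (i' + b) := fun i' h => Nat.find_min hex h
  generalize Nat.find hex = i at hi hmin
  -- Up to time `b` this is the choice of `S`. Between `b` and `i + b` the orbit avoids `I(f)`, so
  -- no hypersurface can reappear.
  have hnot : ∀ m, 1 ≤ m → m ≤ i + b → ¬ f.IterMapsOnto m S := by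
    intro m h1
    induction m with
    | zero => omega
    | succ m ih =>
      intro h2 h3
      rcases Nat.lt_or_ge m b with h4 | h4
      · exact hlast (m + 1) h1 (by omega) h3
      · refine ih (by omega) (by omega) (h3.of_succ hS.1 hl' ?_)
        have := hmin (m - b) (by omega)
        rwa [Nat.sub_add_cancel h4] at this
  obtain ⟨hle, hK⟩ := hf.le_height hS.1 hl' (by omega) hi hnot
  rcases Nat.lt_or_ge n₀ b with h | h
  · obtain ⟨m, h1, h2, h3⟩ := hf.exists_iterMapsOnto hS.1 hl' hK (by omega) hi
    exact hnot m h1 h2 h3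
  · obtain ⟨e, he, -⟩ := f.exists_isHomogeneous_cofactor n₀
    have hne := f.cofactor_ne_zero n₀
    refine hf.not_dvd S l' b _ e hS.1 hl' hK hb h hne he (fun R hR hRd => ?_) hd
    obtain ⟨r, hr⟩ := exists_isHomogeneous_of_dvd he hne hRd
    exact hf.component_of_dvd_cofactor hR hr hRd

/-- In `x c' = c^d y`, with `x = h_{n₀} ∘ F_j` and `y = h_{n₀+j}`, the map `f^j` sends each prime
factor of `y` onto a hypersurface, so it divides neither `c` nor `c'`. The prime factors of `x`
divide `y`, so both divisibilities follow by coprimality. -/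
theorem associated_cofactor (hf : f.IsQuasiStable n₀ K) (j : ℕ) :
    Associated (bind₁ (f.iter j).lift (f.cofactor n₀)) (f.cofactor (n₀ + j)) := by
  obtain ⟨c, -, hc⟩ := f.exists_iter_comp_iter n₀ j
  obtain ⟨c', -, hc'⟩ := f.exists_iter_comp_iter (n₀ + 1) j
  have key := f.bind₁_cofactor_mul hc hc'
  set x := bind₁ (f.iter j).lift (f.cofactor n₀) with hx
  have hx0 : x ≠ 0 := bind₁_ne_zero (f.iter j).dominating (f.cofactor_ne_zero n₀)
  have hy0 := f.cofactor_ne_zero (n₀ + j)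
  obtain ⟨e, he, -⟩ := f.exists_isHomogeneous_cofactor (n₀ + j)
  obtain ⟨e₀, he₀, -⟩ := f.exists_isHomogeneous_cofactor n₀
  have hxe := (f.iter j).isHomogeneous_bind₁ he₀
  have hyc : ∀ P, Irreducible P → P ∣ f.cofactor (n₀ + j) → ¬ P ∣ c ∧ ¬ P ∣ c' := by
    intro P hP hPy
    obtain ⟨l, hl⟩ := exists_isHomogeneous_of_dvd he hy0 hPy
    obtain ⟨-, S, hS⟩ := hf.exists_mapsOnto_of_dvd_cofactor hP hl hPy
    rw [Nat.add_sub_cancel_left] at hS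
    exact ⟨hS.not_dvd hc, hS.not_dvd hc'⟩
  have hxc : ∀ P, Irreducible P → P ∣ x → ¬ P ∣ c := by
    intro P hP hPx
    obtain ⟨l, hl⟩ := exists_isHomogeneous_of_dvd hxe hx0 hPx
    exact (hyc P hP (hf.dvd_cofactor_of_dvd_bind₁ hP hl hPx)).1
  refine associated_of_dvd_dvd ?_ ?_
  · have hrel : IsRelPrime x (c ^ f.deg) :=
      WfDvdMonoid.isRelPrime_of_no_irreducible_factors (fun h => hx0 h.1) fun P hP hPx hPc =>
        hxc P hP hPx (hP.prime.dvd_of_dvd_pow hPc)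
    exact hrel.dvd_of_dvd_mul_left (Dvd.intro _ key)
  · have hrel : IsRelPrime (f.cofactor (n₀ + j)) c' :=
      WfDvdMonoid.isRelPrime_of_no_irreducible_factors (fun h => hy0 h.1) fun P hP hPy =>
        (hyc P hP hPy).2
    exact hrel.dvd_of_dvd_mul_right (Dvd.intro_left _ key.symm)

/-- The linear recursion for the degrees of the iterates. -/
theorem exists_deg_iter_recursion (hf : f.IsQuasiStable n₀ K) :
    ∃ h : ℕ, ∀ n, f.deg * (f.iter n).deg =
      (if n < n₀ then 0 else h * (f.iter (n - n₀)).deg) + (f.iter (n + 1)).deg := by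
  obtain ⟨e₀, he₀, -⟩ := f.exists_isHomogeneous_cofactor n₀
  refine ⟨e₀, fun n => ?_⟩
  obtain ⟨e, he, hdeg⟩ := f.exists_isHomogeneous_cofactor n
  have hy0 := f.cofactor_ne_zero n
  rw [hdeg]
  congr 1
  split_ifs with hn
  · have hu : IsUnit (f.cofactor n) := by
      by_contra hu
      obtain ⟨P, hP, hPd⟩ := WfDvdMonoid.exists_irreducible_factor hu hy0
      obtain ⟨l, hl⟩ := exists_isHomogeneous_of_dvd he hy0 hPd
      have := (hf.exists_mapsOnto_of_dvd_cofactor hP hl hPd).1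
      omega
    exact Nat.le_zero.mp (le_of_dvd_of_isHomogeneous he (isHomogeneous_one _ _) one_ne_zero hu.dvd)
  · obtain ⟨j, rfl⟩ := Nat.exists_eq_add_of_le (not_lt.mp hn)
    have hass := hf.associated_cofactor j
    have hx := (f.iter j).isHomogeneous_bind₁ he₀
    rw [Nat.add_sub_cancel_left, mul_comm]
    exact le_antisymm
      (le_of_dvd_of_isHomogeneous he hx (hass.ne_zero_iff.mpr hy0) hass.symm.dvd)
      (le_of_dvd_of_isHomogeneous hx he hy0 hass.dvd)

end IsQuasiStable

/-! ### From the geometric definitions to `IsQuasiStable`. -/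

theorem image_iter_subset_indet_iff (f : DominatingMap k) (n : ℕ)
    {P : MvPolynomial (Fin (k + 1)) ℂ} {l : ℕ} (hP : Irreducible P) (hPl : P.IsHomogeneous l) :
    (f.iter n).image (zeroLocus P) ⊆ f.indet ↔ P ∣ f.cofactor n := by
  rw [f.dvd_cofactor_iff n hP]
  simp only [← (f.iter n).image_subset_zeroLocus_iff hP hPl (f.homog _)]
  exact ⟨fun h i q hq => h hq i, fun h q hq i => h i hq⟩

theorem codimGtOne_image_iter_iff (f : DominatingMap k) (n : ℕ)
    {P : MvPolynomial (Fin (k + 1)) ℂ} {l : ℕ} (hP : Irreducible P) (hPl : P.IsHomogeneous l) :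
    CodimGtOne ((f.iter n).image (zeroLocus P)) ↔ ¬ f.IterMapsOnto n P := by
  rw [IterMapsOnto, ← (f.iter n).not_codimGtOne_image_iff hP hPl, not_not]

/-- No irreducible polynomial divides a cofactor, so the value `n₀ = 0` and the empty set of
components serve; the recursion then has `h = 0`. -/
theorem IsAS.isQuasiStable {f : DominatingMap k} (hf : f.IsAS) :
    f.IsQuasiStable 0 fun _ => False where
  height _ _ t hP hPl ht hd _ _ :=
    absurd ((f.image_iter_subset_indet_iff t hP hPl).mpr hd)
      (hf _ t (isHypersurface_zeroLocus hP hPl) ht)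
  not_dvd _ _ _ _ _ _ _ h := h.elim
  orbit _ _ _ _ h := h.elim

/-- `K P` is taken to be `zeroLocus P ⊆ H₀`, so no equation of `H₀` and no finiteness of the union
defining it is needed. -/
theorem IsQAS.exists_isQuasiStable {f : DominatingMap k} (hf : f.IsQAS) :
    ∃ n₀ K, f.IsQuasiStable n₀ K := by
  rcases hf with hf | ⟨H₀, n₀, ⟨-, huniq⟩, hii, hiii⟩
  · exact ⟨_, _, hf.isQuasiStable⟩
  refine ⟨n₀, fun P => zeroLocus P ⊆ H₀, ?_, ?_, ?_⟩
  · intro P l t hP hPl ht hd hmin hnot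
    have hprim : f.IsPrimitiveComponent (zeroLocus P) t := by
      refine ⟨⟨P, l, hP, hPl, rfl⟩,
        ⟨⟨ht, (f.image_iter_subset_indet_iff t hP hPl).mpr hd⟩, ?_⟩, fun m h1 h2 =>
        (f.codimGtOne_image_iter_iff m hP hPl).mpr (hnot m h1 h2)⟩
      rintro s ⟨hs1, hs2⟩
      by_contra hst
      exact hmin s hs1 (not_le.mp hst) ((f.image_iter_subset_indet_iff s hP hPl).mp hs2)
    obtain ⟨h1, h2⟩ := huniq _ t ⟨⟨_, hprim⟩, rfl⟩
    refine ⟨h2, ?_⟩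
    rw [← h1]
    exact Set.subset_sUnion_of_mem hprim
  · intro P l m Q e hP hPl hK h1 h2 hQ0 hQe hQ hd
    refine hii _ ⟨⟨P, l, hP, hPl, rfl⟩, hK⟩ m h1 h2 ?_
    refine (((f.iter m).image_subset_zeroLocus_iff hP hPl hQe).mpr hd).trans fun p hp => ?_
    obtain ⟨R, hR, hRQ, hpR⟩ := exists_dvd_of_mem_zeroLocus hQe hQ0 hp
    exact hQ R hR hRQ hpR
  · intro P l hP hPl hK
    simp only [← f.image_iter_subset_indet_iff _ hP hPl]
    refine (hiii _ ⟨⟨P, l, hP, hPl, rfl⟩, hK⟩).imp_right ?_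
    rintro ⟨m₀, h1, h2, h3⟩
    refine ⟨m₀, h1, ?_, h3⟩
    have := h2.not_codimGtOne
    rwa [f.codimGtOne_image_iter_iff _ hP hPl, not_not] at this

end DominatingMap

/-! ### Asymptotics of the degree recursion. -/

/-- The logarithmic means of a sequence whose successive ratios converge. -/
theorem tendsto_rpow_one_div_of_tendsto_ratio {u : ℕ → ℝ} {L : ℝ} (hu : ∀ n, 0 < u n)
    (hL : 0 < L) (h : Tendsto (fun n => u (n + 1) / u n) atTop (𝓝 L)) :
    Tendsto (fun n : ℕ => u n ^ (1 / (n : ℝ))) atTop (𝓝 L) := by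
  have hlog : Tendsto (fun n => Real.log (u (n + 1)) - Real.log (u n)) atTop
      (𝓝 (Real.log L)) := by
    refine ((Real.continuousAt_log hL.ne').tendsto.comp h).congr fun n => ?_
    exact Real.log_div (hu _).ne' (hu _).ne'
  -- The Cesàro means of the differences telescope to `(log u_n - log u_0) / n`.
  have h1 := hlog.cesaro
  simp only [Finset.sum_range_sub fun n => Real.log (u n)] at h1
  have h2 : Tendsto (fun n : ℕ => (n : ℝ)⁻¹ * Real.log (u 0)) atTop (𝓝 0) := by
    simpa using tendsto_inv_atTop_nhds_zero_nat.mul_const (Real.log (u 0))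
  have h3 := h1.add h2
  rw [add_zero] at h3
  have h4 := (Real.continuous_exp.tendsto _).comp h3
  rw [Real.exp_log hL] at h4
  refine h4.congr fun n => ?_
  rw [Real.rpow_def_of_pos (hu n), Function.comp_apply]
  congr 1
  ring

/-- Convergence of the ratios of a positive solution of the recursion
`u (n + 1) = d * u n - h * u (n - n₀)`. -/
theorem exists_tendsto_ratio_of_recursion {u : ℕ → ℕ} (hu : ∀ n, 0 < u n) {d h n₀ : ℕ}
    (hrec : ∀ n, d * u n = (if n < n₀ then 0 else h * u (n - n₀)) + u (n + 1)) :
    ∃ L : ℝ, 0 < L ∧ IsIntegral ℤ L ∧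
      Tendsto (fun n => (u (n + 1) : ℝ) / u n) atTop (𝓝 L) := by
  have hu' : ∀ n, (0 : ℝ) < u n := fun n => by exact_mod_cast hu n
  set r : ℕ → ℝ := fun n => (u (n + 1) : ℝ) / u n with hr
  have hr0 : ∀ n, 0 < r n := fun n => div_pos (hu' _) (hu' _)
  have hprod : ∀ n m, ∏ i ∈ Finset.range m, r (n + i) = (u (n + m) : ℝ) / u n := by
    intro n m
    induction m with
    | zero => simp [(hu' n).ne']
    | succ m ih =>
      rw [Finset.prod_range_succ, ih, hr, ← add_assoc]
      field_simp [(hu' n).ne', (hu' (n + m)).ne']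
  have hsmall : ∀ n < n₀, r n = d := by
    intro n hn
    have := hrec n
    rw [if_pos hn, zero_add] at this
    rw [hr, div_eq_iff (hu' n).ne']
    exact_mod_cast this.symm
  -- The recursion divided by `u n`: each ratio is `d - h / B`, where `B` is the product of the
  -- preceding `n₀` ratios.
  have hlarge : ∀ n, r (n₀ + n) * ∏ i ∈ Finset.range n₀, r (n + i) =
      d * (∏ i ∈ Finset.range n₀, r (n + i)) - h := by
    intro n
    have := hrec (n₀ + n)
    rw [if_neg (by omega), Nat.add_sub_cancel_left] at this
    have h1 : (d : ℝ) * u (n₀ + n) = h * u n + u (n₀ + n + 1) := by exact_mod_cast this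
    rw [hprod, hr, add_comm n n₀]
    have h2 := (hu' n).ne'
    have h3 := (hu' (n₀ + n)).ne'
    field_simp
    linarith
  have hP0 : ∀ n, 0 < ∏ i ∈ Finset.range n₀, r (n + i) := fun n =>
    Finset.prod_pos fun i _ => hr0 _
  have hle : ∀ n, r (n₀ + n) ≤ d := by
    intro n
    have h1 := hlarge n
    have h2 : (0 : ℝ) ≤ h := Nat.cast_nonneg h
    by_contra! hcon
    have := mul_lt_mul_of_pos_right hcon (hP0 n)
    linarith
  -- If the earlier ratios decrease, so does the product `B`, hence also `d - h / B`; the initial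
  -- ratios are `d`, the largest possible value.
  have hanti : ∀ n, r (n + 1) ≤ r n := by
    intro n
    induction n using Nat.strong_induction_on with
    | _ n ih =>
    rcases Nat.lt_or_ge n n₀ with hn | hn
    · rw [hsmall n hn]
      rcases Nat.lt_or_ge (n + 1) n₀ with hn' | hn'
      · rw [hsmall _ hn']
      · obtain ⟨j, hj⟩ := Nat.exists_eq_add_of_le hn'
        rw [hj]; exact hle j
    · obtain ⟨j, rfl⟩ := Nat.exists_eq_add_of_le hn
      have h1 := hlarge j
      have h2 := hlarge (j + 1)
      have h3 : ∏ i ∈ Finset.range n₀, r (j + 1 + i) ≤ ∏ i ∈ Finset.range n₀, r (j + i) := by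
        refine Finset.prod_le_prod (fun i _ => (hr0 _).le) fun i hi => ?_
        rw [show j + 1 + i = j + i + 1 by omega]
        exact ih _ (by have := Finset.mem_range.mp hi; omega)
      have h4 : (0 : ℝ) ≤ h := Nat.cast_nonneg h
      rw [show n₀ + j + 1 = n₀ + (j + 1) by omega]
      have hA := hP0 (j + 1)
      have hB := hP0 j
      set A := ∏ i ∈ Finset.range n₀, r (j + 1 + i)
      set B := ∏ i ∈ Finset.range n₀, r (j + i)
      have e1 : r (n₀ + j) = d - h / B := by field_simp; linarith
      have e2 : r (n₀ + (j + 1)) = d - h / A := by field_simp; linarith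
      rw [e1, e2]
      have := div_le_div_of_nonneg_left h4 hA h3
      linarith
  have hant : Antitone r := antitone_nat_of_succ_le hanti
  have hbdd : BddBelow (Set.range r) := ⟨0, by rintro _ ⟨n, rfl⟩; exact (hr0 n).le⟩
  have hlim := tendsto_atTop_ciInf hant hbdd
  set L := ⨅ n, r n
  -- With `L < 1` the sequence would decay geometrically, which positive integers cannot do.
  have hL1 : 1 ≤ L := by
    by_contra! hL
    obtain ⟨q, hLq, hq1⟩ := exists_between hL
    obtain ⟨N, hN⟩ := (hlim.eventually_lt_const hLq).exists
    have hrq : ∀ i, r (N + i) ≤ q := fun i => (hant (Nat.le_add_right N i)).trans hN.le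
    have hq0 : 0 ≤ q := (hr0 N).le.trans hN.le
    have hbound : ∀ m, 1 / (u N : ℝ) ≤ q ^ m := by
      intro m
      have h1 : ∏ i ∈ Finset.range m, r (N + i) ≤ ∏ _i ∈ Finset.range m, q :=
        Finset.prod_le_prod (fun i _ => (hr0 _).le) fun i _ => hrq i
      rw [hprod, Finset.prod_const, Finset.card_range] at h1
      refine le_trans ?_ h1
      have : (1 : ℝ) ≤ u (N + m) := by exact_mod_cast hu (N + m)
      gcongr
    have h0 := ge_of_tendsto' (tendsto_pow_atTop_nhds_zero_of_lt_one hq0 hq1) hbound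
    exact absurd (one_div_pos.mpr (hu' N)) (not_lt.mpr h0)
  refine ⟨L, by linarith, ?_, hlim⟩
  have hshift : ∀ i, Tendsto (fun n => r (n + i)) atTop (𝓝 L) := fun i =>
    hlim.comp (tendsto_add_atTop_nat i)
  have hprodlim : Tendsto (fun n => ∏ i ∈ Finset.range n₀, r (n + i)) atTop (𝓝 (L ^ n₀)) := by
    have := tendsto_finsetProd (Finset.range n₀) fun i _ => hshift i
    simpa using this
  have hshift' : Tendsto (fun n => r (n₀ + n)) atTop (𝓝 L) := by
    simpa only [add_comm n₀] using hshift n₀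
  have heq : L * L ^ n₀ = d * L ^ n₀ - h :=
    tendsto_nhds_unique ((hshift'.mul hprodlim).congr hlarge)
      ((hprodlim.const_mul (d : ℝ)).sub_const (h : ℝ))
  -- The limit equation `L^{n₀+1} = d L^{n₀} - h` is monic with integer coefficients.
  refine ⟨Polynomial.X ^ (n₀ + 1) - (Polynomial.C (d : ℤ) * Polynomial.X ^ n₀ -
    Polynomial.C (h : ℤ)), ?_, ?_⟩
  · refine Polynomial.monic_X_pow_sub
      (lt_of_le_of_lt (b := (n₀ : WithBot ℕ)) ?_ (by exact_mod_cast Nat.lt_succ_self n₀))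
    refine (Polynomial.degree_sub_le (Polynomial.C (d : ℤ) * Polynomial.X ^ n₀)
      (Polynomial.C (h : ℤ))).trans (max_le ?_ ?_)
    · exact Polynomial.degree_C_mul_X_pow_le _ _
    · exact Polynomial.degree_C_le.trans (by exact_mod_cast Nat.zero_le _)
  · simp only [Polynomial.eval₂_sub, Polynomial.eval₂_mul, Polynomial.eval₂_pow,
      Polynomial.eval₂_X, Polynomial.eval₂_C]
    simp only [eq_intCast, Int.cast_natCast]
    rw [pow_succ']
    linarith

end ProjDyn

theorem mainTheorem2 (k : ℕ) (hk : 2 ≤ k) (f : ProjDyn.DominatingMap k) (hf : f.IsQAS) :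
    Tendsto (fun n : ℕ => ((f.iter n).deg : ℝ) ^ (1 / (n : ℝ))) atTop
        (𝓝 f.firstDynamicalDegree) ∧
      IsIntegral ℤ f.firstDynamicalDegree ∧
      Tendsto (fun n : ℕ => ((f.iter (n + 1)).deg : ℝ) / ((f.iter n).deg : ℝ)) atTop
        (𝓝 f.firstDynamicalDegree) := by
  obtain ⟨n₀, K, hK⟩ := hf.exists_isQuasiStable
  obtain ⟨h, hrec⟩ := hK.exists_deg_iter_recursion
  obtain ⟨L, hL, hint, hlim⟩ :=
    ProjDyn.exists_tendsto_ratio_of_recursion (fun n => (f.iter n).deg_pos) hrec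
  have hroot := ProjDyn.tendsto_rpow_one_div_of_tendsto_ratio
    (u := fun n => ((f.iter n).deg : ℝ)) (fun n => Nat.cast_pos.mpr (f.iter n).deg_pos) hL hlim
  have hLeq : f.firstDynamicalDegree = L := hroot.limUnder_eq
  rw [hLeq]
  exact ⟨hroot, hint, hlim⟩
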